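/- Let $\mathfrak g=\mathfrak g_0\oplus\mathfrak g_1$ be the complex simple Lie algebra of type $E_7$ with its $\mathbb Z/2\mathbb Z$-grading in which $\mathfrak g_0=\mathfrak{sl}(8,\mathbb C)$ and $\mathfrak g_1=\bigwedge^4\mathbb C^8$. Explicitly, $\mathfrak g_0$ acts on $\mathfrak g_1$ in the natural way, and for $u,v\in\mathfrak g_1$ the bracket $[u,v]\in\mathfrak{sl}(8,\mathbb C)$ is determined by $\operatorname{tr}(A[u,v])\,e_1\wedge\dots\wedge e_8=(A\cdot u)\wedge v$ for all $A\in\mathfrak{sl}(8,\mathbb C)$. The group $\mathrm{SL}(8,\mathbb C)$ acts on $\mathfrak g_0$ by conjugation and on $\mathfrak g_1$ in the natural way. Let $\sigma$ denote complex conjugation of matrix entries on $\mathfrak g_0$ and on $\mathrm{SL}(8,\mathbb C)$, and of coordinates with respect to the standard basis on $\mathfrak g_1$. The fixed points of $\sigma$ in $\mathfrak g_0$, $\mathfrak g_1$, $\mathrm{SL}(8,\mathbb C)$ are $\mathfrak{sl}(8,\mathbb R)$, $\bigwedge^4\mathbb R^8$, $\mathrm{SL}(8,\mathbb R)$. Let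 $h\in\mathfrak{sl}(8,\mathbb R)$ and $e,f\in\bigwedge^4\mathbb R^8$ satisfy $[h,e]=2e$, $[h,f]=-2f$, $[e,f]=h$, and put $$Z=\{g\in\mathrm{SL}(8,\mathbb C)\mid g\cdot h=h,\ g\cdot e=e,\ g\cdot f=f\},$$ which is stable under $\sigma$. Let $H^1(Z,\sigma)$ be the set of all $c\in Z$ with $c\,\sigma(c)=1$ modulo the equivalence relation $c\sim zc\,\sigma(z)^{-1}$ $(z\in Z)$. Then for every $c\in Z$ with $c\,\sigma(c)=1$ there is $g\in\mathrm{SL}(8,\mathbb C)$ with $g^{-1}\sigma(g)=c$. Moreover, there is a bijection from $H^1(Z,\sigma)$ onto the set of $\mathrm{SL}(8,\mathbb R)$-orbits in $(\mathrm{SL}(8,\mathbb C)\cdot e)\cap\bigwedge^4\mathbb R^8$ such that, for every such $c$ and every $g\in\mathrm{SL}(8,\mathbb C)$ with $g^{-1}\sigma(g)=c$, the element $g\cdot e$ lies in $\bigwedge^4\mathbb R^8$ and the class $[c]$ is sent to the orbit $\mathrm{SL}(8,\mathbb R)\cdot(g\cdot e)$. -/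

import Mathlib

noncomputable section

open Matrix

namespace SL8

/-- The space `ℂ⁸`. -/
abbrev V : Type := Fin 8 → ℂ

/-- The space `⋀⁴ ℂ⁸` of complex four-vectors. -/
abbrev Wedge4 : Type := ⋀[ℂ]^4 V

theorem sum_update_alternating {ι N : Type} [Fintype ι] [DecidableEq ι] [AddCommGroup N] [Module ℂ N]
    (f : V [⋀^ι]→ₗ[ℂ] N) (A : V →ₗ[ℂ] V) (v : ι → V) (i j : ι) (h : v i = v j) (hij : i ≠ j) :
    ∑ k, f (Function.update v k (A (v k))) = 0 := by
  rw [← Finset.sum_subset (Finset.subset_univ {i, j})]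
  · rw [Finset.sum_pair hij]
    have h1 : Function.update v j (A (v j)) =
        (Function.update v i (A (v i))) ∘ Equiv.swap i j := by
      ext k : 1
      by_cases hk : k = i
      · subst hk; simp [Function.update_of_ne hij, Function.update_of_ne hij.symm, h]
      · by_cases hk' : k = j
        · subst hk'; simp [h]
        · simp [Function.update_of_ne hk, Function.update_of_ne hk', Equiv.swap_apply_of_ne_of_ne hk hk']
    rw [h1, AlternatingMap.map_swap _ _ hij, add_neg_cancel]
  · intro k _ hk
    simp only [Finset.mem_insert, Finset.mem_singleton, not_or] at hk
    exact f.map_eq_zero_of_eq _ (by simp [Function.update_of_ne (Ne.symm hk.1), Function.update_of_ne (Ne.symm hk.2), h]) hij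

/-- The alternating map `(v₁, …, vₙ) ↦ ∑ₖ f(v₁, …, A vₖ, …, vₙ)`. -/
def derivAlternating {ι N : Type} [Fintype ι] [DecidableEq ι] [AddCommGroup N] [Module ℂ N]
    (f : V [⋀^ι]→ₗ[ℂ] N) (A : V →ₗ[ℂ] V) : V [⋀^ι]→ₗ[ℂ] N where
  toMultilinearMap := ∑ k, f.toMultilinearMap.compLinearMap (fun i => if i = k then A else LinearMap.id)
  map_eq_zero_of_eq' := by
    intro v i j h hij
    have := sum_update_alternating f A v i j h hij
    simp only [MultilinearMap.toFun_eq_coe, _root_.sum_apply, MultilinearMap.compLinearMap_apply]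
    rw [← this]
    refine Finset.sum_congr rfl fun k _ => ?_
    change f _ = f _
    congr 1
    ext l : 1
    by_cases hl : l = k
    · subst hl; simp
    · simp [hl]

theorem derivAlternating_apply {ι N : Type} [Fintype ι] [DecidableEq ι] [AddCommGroup N] [Module ℂ N]
    (f : V [⋀^ι]→ₗ[ℂ] N) (A : V →ₗ[ℂ] V) (v : ι → V) :
    derivAlternating f A v = ∑ k, f (Function.update v k (A (v k))) := by
  simp only [derivAlternating, AlternatingMap.coe_mk, MultilinearMap.coe_mk, _root_.sum_apply, MultilinearMap.compLinearMap_apply]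
  refine Finset.sum_congr rfl fun k _ => ?_
  change f _ = f _
  congr 1
  ext l : 1
  by_cases hl : l = k
  · subst hl; simp
  · simp [hl]

/-- The action of matrices on `⋀⁴ ℂ⁸` by derivations:
`A · (v₁ ∧ v₂ ∧ v₃ ∧ v₄) = A v₁ ∧ v₂ ∧ v₃ ∧ v₄ + ⋯ + v₁ ∧ v₂ ∧ v₃ ∧ A v₄`. -/
def act : Matrix (Fin 8) (Fin 8) ℂ →ₗ[ℂ] Wedge4 →ₗ[ℂ] Wedge4 where
  toFun A := exteriorPower.alternatingMapLinearEquiv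
    (derivAlternating (exteriorPower.ιMulti ℂ 4) (Matrix.toLin' A))
  map_add' A B := by
    ext v : 2
    simp [derivAlternating_apply, AlternatingMap.map_update_add, Finset.sum_add_distrib, Matrix.add_mulVec]
  map_smul' c A := by
    ext v : 2
    simp [derivAlternating_apply, AlternatingMap.map_update_smul, Finset.smul_sum, Matrix.smul_mulVec]

theorem act_ιMulti (A : Matrix (Fin 8) (Fin 8) ℂ) (v : Fin 4 → V) :
    act A (exteriorPower.ιMulti ℂ 4 v) =
      ∑ k, exteriorPower.ιMulti ℂ 4 (Function.update v k (A *ᵥ v k)) := by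
  simp only [act, LinearMap.coe_mk, AddHom.coe_mk,
    exteriorPower.alternatingMapLinearEquiv_apply_ιMulti, derivAlternating_apply, Matrix.toLin'_apply]

theorem wedge4_induction {p : Wedge4 → Prop} (h0 : p 0) (hadd : ∀ x y, p x → p y → p (x + y))
    (hsmul : ∀ (c : ℂ) x, p x → p (c • x)) (h : ∀ v, p (exteriorPower.ιMulti ℂ 4 v)) (x : Wedge4) :
    p x := by
  have hx : x ∈ Submodule.span ℂ (Set.range (exteriorPower.ιMulti ℂ 4 (M := V))) := by
    rw [exteriorPower.ιMulti_span]; trivial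
  induction hx using Submodule.span_induction with
  | mem x hx => obtain ⟨v, rfl⟩ := hx; exact h v
  | zero => exact h0
  | add x y _ _ hx hy => exact hadd x y hx hy
  | smul c x _ hx => exact hsmul c x hx

theorem linearMap_wedge4_ext {N : Type} [AddCommGroup N] [Module ℂ N] {f g : Wedge4 →ₗ[ℂ] N}
    (h : ∀ v, f (exteriorPower.ιMulti ℂ 4 v) = g (exteriorPower.ιMulti ℂ 4 v)) : f = g :=
  exteriorPower.linearMap_ext (AlternatingMap.ext h)

theorem act_act_ιMulti (A B : Matrix (Fin 8) (Fin 8) ℂ) (v : Fin 4 → V) :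
    act A (act B (exteriorPower.ιMulti ℂ 4 v)) =
      (∑ k, exteriorPower.ιMulti ℂ 4 (Function.update v k ((A * B) *ᵥ v k))) +
      ∑ k, ∑ l, if k = l then 0 else exteriorPower.ιMulti ℂ 4
        (Function.update (Function.update v k (B *ᵥ v k)) l (A *ᵥ v l)) := by
  rw [act_ιMulti, map_sum, ← Finset.sum_add_distrib]
  refine Finset.sum_congr rfl fun k _ => ?_
  rw [act_ιMulti, ← Finset.add_sum_erase _ _ (Finset.mem_univ k),
    ← Finset.add_sum_erase (a := k) Finset.univ (fun l => if k = l then _ else _) (Finset.mem_univ k)]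
  simp only [Function.update_self, Function.update_idem, Matrix.mulVec_mulVec, if_true, zero_add]
  congr 1
  refine Finset.sum_congr rfl fun l hl => ?_
  have hl' : l ≠ k := Finset.ne_of_mem_erase hl
  rw [if_neg hl'.symm, Function.update_of_ne hl']

theorem act_lie (A B : Matrix (Fin 8) (Fin 8) ℂ) (x : Wedge4) :
    act (A * B - B * A) x = act A (act B x) - act B (act A x) := by
  have : act (A * B - B * A) = act A ∘ₗ act B - act B ∘ₗ act A := by
    refine linearMap_wedge4_ext fun v => ?_
    simp only [LinearMap.sub_apply, LinearMap.comp_apply, act_act_ιMulti]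
    rw [map_sub, LinearMap.sub_apply, act_ιMulti, act_ιMulti]
    have : ∀ f g h k : Wedge4, h = k → f - g = f + h - (g + k) := by rintro f g h k rfl; abel
    apply this
    rw [Finset.sum_comm]
    refine Finset.sum_congr rfl fun k _ => Finset.sum_congr rfl fun l _ => ?_
    by_cases hkl : k = l
    · simp [hkl]
    · rw [if_neg hkl, if_neg (Ne.symm hkl), Function.update_comm hkl]
  rw [this]; rfl

theorem act_one (x : Wedge4) : act 1 x = (4 : ℂ) • x := by
  have : act 1 = (4 : ℂ) • LinearMap.id := by
    refine linearMap_wedge4_ext fun v => ?_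
    rw [act_ιMulti]
    simp only [Matrix.one_mulVec, Function.update_eq_self, Finset.sum_const, Finset.card_univ,
      Fintype.card_fin, LinearMap.smul_apply, LinearMap.id_apply]
    rw [← Nat.cast_smul_eq_nsmul ℂ]
    norm_num
  rw [this]; rfl

/-- The determinant, as an alternating form on `ℂ⁸`. -/
def det8 : V [⋀^Fin 8]→ₗ[ℂ] ℂ := Matrix.detRowAlternating

/-- The volume form: the linear form on the exterior algebra of `ℂ⁸` that sends
`v₁ ∧ ⋯ ∧ v₈` to `det(v₁, …, v₈)` and vanishes in all degrees other than `8`. -/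
def vol : ExteriorAlgebra ℂ V →ₗ[ℂ] ℂ := ExteriorAlgebra.liftAlternating (Pi.single 8 det8)

theorem vol_ιMulti (v : Fin 8 → V) : vol (ExteriorAlgebra.ιMulti ℂ 8 v) = det8 v := by
  rw [vol, ExteriorAlgebra.liftAlternating_apply_ιMulti, Pi.single_eq_same]

/-- The pairing `⟨u, v⟩ = vol(u ∧ v)` on `⋀⁴ ℂ⁸`. -/
def wedgePairing : Wedge4 →ₗ[ℂ] Wedge4 →ₗ[ℂ] ℂ :=
  ((LinearMap.mul ℂ (ExteriorAlgebra ℂ V)).compl₁₂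
    (Submodule.subtype _) (Submodule.subtype _)).compr₂ vol

theorem wedgePairing_apply (u v : Wedge4) :
    wedgePairing u v = vol ((u : ExteriorAlgebra ℂ V) * v) := rfl

/-- The concatenation of two quadruples. -/
def app {α : Type} (a b : Fin 4 → α) : Fin 8 → α := Fin.append (m := 4) (n := 4) a b

theorem wedgePairing_ιMulti (a b : Fin 4 → V) :
    wedgePairing (exteriorPower.ιMulti ℂ 4 a) (exteriorPower.ιMulti ℂ 4 b) =
      det8 (app a b) := by
  rw [wedgePairing_apply, exteriorPower.ιMulti_apply_coe, exteriorPower.ιMulti_apply_coe,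
    ExteriorAlgebra.ιMulti_mul_ιMulti]
  exact vol_ιMulti (app a b)

theorem wedgePairing_comm (u v : Wedge4) : wedgePairing u v = wedgePairing v u := by
  induction u using wedge4_induction with
  | h0 => simp
  | hadd x y hx hy => simp [hx, hy]
  | hsmul c x hx => simp [hx]
  | h a =>
    induction v using wedge4_induction with
    | h0 => simp
    | hadd x y hx hy => simp [hx, hy]
    | hsmul c x hx => simp [hx]
    | h b =>
      rw [wedgePairing_ιMulti, wedgePairing_ιMulti]
      have : app a b = app b a ∘ (Equiv.addRight (4 : Fin 8)) := by
        ext i j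
        fin_cases i <;> rfl
      rw [this, AlternatingMap.map_perm]
      have : Equiv.Perm.sign (Equiv.addRight (4 : Fin 8)) = 1 := by decide +kernel
      rw [this, one_smul]

theorem sum_det_updateRow {n : Type} [Fintype n] [DecidableEq n] (A M : Matrix n n ℂ) :
    ∑ k, (M.updateRow k (A *ᵥ M k)).det = A.trace * M.det := by
  have h : ∀ k, (M.updateRow k (A *ᵥ M k)).det = (Mᵀ.adjugate * (A * Mᵀ)) k k := by
    intro k
    rw [← Matrix.cramer_transpose_apply, Matrix.cramer_eq_adjugate_mulVec]
    rfl
  simp only [h]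
  change Matrix.trace _ = _
  rw [Matrix.trace_mul_comm, Matrix.mul_assoc, Matrix.mul_adjugate, Matrix.det_transpose,
    Matrix.mul_smul, Matrix.mul_one, Matrix.trace_smul, smul_eq_mul, mul_comm]

theorem sum_detRow_update {n : Type} [Fintype n] [DecidableEq n] (A : Matrix n n ℂ)
    (v : n → n → ℂ) :
    ∑ k, Matrix.detRowAlternating (Function.update v k (A *ᵥ v k)) =
      A.trace * Matrix.detRowAlternating v :=
  sum_det_updateRow A (Matrix.of v)

theorem sum_det_update (A : Matrix (Fin 8) (Fin 8) ℂ) (v : Fin 8 → V) :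
    ∑ k, det8 (Function.update v k (A *ᵥ v k)) = A.trace * det8 v := by
  have := sum_detRow_update A v
  rw [← det8] at this
  convert this

theorem sum_fin8 {N : Type} [AddCommMonoid N] (f : Fin 8 → N) :
    ∑ k, f k = ∑ k : Fin 4, f (Fin.castAdd 4 k) + ∑ k : Fin 4, f (Fin.natAdd 4 k) :=
  Fin.sum_univ_add (a := 4) (b := 4) f

theorem app_castAdd {α : Type} (a b : Fin 4 → α) (k : Fin 4) : app a b (Fin.castAdd 4 k) = a k :=
  Fin.append_left (m := 4) (n := 4) a b k

theorem app_natAdd {α : Type} (a b : Fin 4 → α) (k : Fin 4) : app a b (Fin.natAdd 4 k) = b k :=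
  Fin.append_right (m := 4) (n := 4) a b k

theorem app_update_left {α : Type} (a b : Fin 4 → α) (k : Fin 4) (x : α) :
    app (Function.update a k x) b = Function.update (app a b) (Fin.castAdd 4 k) x := by
  ext i
  fin_cases k <;> fin_cases i <;> rfl

theorem app_update_right {α : Type} (a b : Fin 4 → α) (k : Fin 4) (x : α) :
    app a (Function.update b k x) = Function.update (app a b) (Fin.natAdd 4 k) x := by
  ext i
  fin_cases k <;> fin_cases i <;> rfl

theorem wedgePairing_act (A : Matrix (Fin 8) (Fin 8) ℂ) (u v : Wedge4) :
    wedgePairing (act A u) v + wedgePairing u (act A v) = A.trace * wedgePairing u v := by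
  induction u using wedge4_induction with
  | h0 => simp
  | hadd x y hx hy => simp only [map_add, LinearMap.add_apply, mul_add, ← hx, ← hy]; ring
  | hsmul c x hx =>
    simp only [map_smul, LinearMap.smul_apply, smul_eq_mul]
    linear_combination c * hx
  | h a =>
    induction v using wedge4_induction with
    | h0 => simp
    | hadd x y hx hy => simp only [map_add, mul_add, ← hx, ← hy]; ring
    | hsmul c x hx =>
      simp only [map_smul, smul_eq_mul]
      linear_combination c * hx
    | h b =>
      rw [act_ιMulti, act_ιMulti, map_sum, map_sum, LinearMap.sum_apply, wedgePairing_ιMulti,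
        ← sum_det_update]
      simp only [wedgePairing_ιMulti, app_update_left, app_update_right]
      rw [sum_fin8]
      simp only [app_castAdd, app_natAdd]

/-- The bracket `⋀⁴ ℂ⁸ × ⋀⁴ ℂ⁸ → 𝔰𝔩(8, ℂ)`: `[u, v]` is the matrix of trace zero such that
`tr(A [u, v]) = vol((A · u) ∧ v)` for all `A ∈ 𝔰𝔩(8, ℂ)` (see `trace_mul_bracketWedge` and
`trace_bracketWedge`). -/
def bracketWedge : Wedge4 →ₗ[ℂ] Wedge4 →ₗ[ℂ] Matrix (Fin 8) (Fin 8) ℂ :=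
  LinearMap.mk₂ ℂ
    (fun u v => Matrix.of (fun i j => wedgePairing (act (Matrix.single j i 1) u) v) -
      (wedgePairing u v / 2) • (1 : Matrix (Fin 8) (Fin 8) ℂ))
    (fun u u' v => by ext i j; simp; ring)
    (fun c u v => by ext i j; simp; ring)
    (fun u v v' => by ext i j; simp; ring)
    (fun c u v => by ext i j; simp; ring)

theorem bracketWedge_apply (u v : Wedge4) :
    bracketWedge u v = Matrix.of (fun i j => wedgePairing (act (Matrix.single j i 1) u) v) -
      (wedgePairing u v / 2) • (1 : Matrix (Fin 8) (Fin 8) ℂ) := rfl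

theorem trace_mul_bracketWedge (A : Matrix (Fin 8) (Fin 8) ℂ) (u v : Wedge4) :
    (A * bracketWedge u v).trace =
      wedgePairing (act A u) v - A.trace / 2 * wedgePairing u v := by
  rw [bracketWedge_apply, Matrix.mul_sub, Matrix.trace_sub, Matrix.mul_smul, Matrix.trace_smul,
    Matrix.mul_one, smul_eq_mul]
  congr 1
  · conv_rhs => rw [Matrix.matrix_eq_sum_single A]
    simp only [map_sum, LinearMap.sum_apply, Matrix.trace, Matrix.diag, Matrix.mul_apply,
      Matrix.of_apply]
    refine Finset.sum_congr rfl fun i _ => Finset.sum_congr rfl fun j _ => ?_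
    have : Matrix.single i j (A i j) = A i j • Matrix.single i j (1 : ℂ) := by simp
    rw [this]
    simp only [map_smul, LinearMap.smul_apply, smul_eq_mul]
  · ring

theorem trace_bracketWedge (u v : Wedge4) : (bracketWedge u v).trace = 0 := by
  have := trace_mul_bracketWedge 1 u v
  rw [Matrix.one_mul, act_one] at this
  rw [this]; simp; ring

theorem matrix_ext_trace {M N : Matrix (Fin 8) (Fin 8) ℂ}
    (h : ∀ A : Matrix (Fin 8) (Fin 8) ℂ, (A * M).trace = (A * N).trace) : M = N := by
  ext i j
  simpa [Matrix.trace_single_mul] using h (Matrix.single j i 1)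

theorem bracketWedge_swap (u v : Wedge4) : bracketWedge v u = -bracketWedge u v := by
  refine matrix_ext_trace fun A => ?_
  have h := wedgePairing_act A v u
  rw [Matrix.mul_neg, Matrix.trace_neg, trace_mul_bracketWedge, trace_mul_bracketWedge]
  rw [wedgePairing_comm v (act A u), wedgePairing_comm v u] at h
  rw [wedgePairing_comm v u]
  linear_combination h

theorem bracketWedge_self (u : Wedge4) : bracketWedge u u = 0 := by
  have h := bracketWedge_swap u u
  ext i j
  exact self_eq_neg.mp (congrFun (congrFun h i) j)

theorem lie_bracketWedge (A : Matrix (Fin 8) (Fin 8) ℂ) (hA : A.trace = 0) (u v : Wedge4) :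
    A * bracketWedge u v - bracketWedge u v * A =
      bracketWedge (act A u) v + bracketWedge u (act A v) := by
  refine matrix_ext_trace fun B => ?_
  have h1 : (B * (A * bracketWedge u v - bracketWedge u v * A)).trace =
      ((B * A - A * B) * bracketWedge u v).trace := by
    rw [Matrix.mul_sub, Matrix.sub_mul, Matrix.trace_sub, Matrix.trace_sub, ← Matrix.mul_assoc,
      ← Matrix.mul_assoc, Matrix.trace_mul_comm (B * _) A, Matrix.mul_assoc A B]
  have h2 : (B * A - A * B).trace = 0 := by
    rw [Matrix.trace_sub, Matrix.trace_mul_comm, sub_self]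
  have h3 := wedgePairing_act A (act B u) v
  have h4 := wedgePairing_act A u v
  rw [h1, trace_mul_bracketWedge, Matrix.mul_add, Matrix.trace_add, trace_mul_bracketWedge,
    trace_mul_bracketWedge, act_lie, h2, map_sub, LinearMap.sub_apply]
  rw [hA] at h3 h4
  linear_combination -h3 + B.trace / 2 * h4

/-- The Jacobi expression `[[u, v], w] + [[v, w], u] + [[w, u], v]`. -/
def jac (u v w : Wedge4) : Wedge4 :=
  act (bracketWedge u v) w + act (bracketWedge v w) u + act (bracketWedge w u) v

theorem act_jac (A : Matrix (Fin 8) (Fin 8) ℂ) (hA : A.trace = 0) (u v w : Wedge4) :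
    act A (jac u v w) = jac (act A u) v w + jac u (act A v) w + jac u v (act A w) := by
  have h : ∀ x y z, act A (act (bracketWedge x y) z) =
      act (bracketWedge (act A x) y) z + act (bracketWedge x (act A y)) z +
        act (bracketWedge x y) (act A z) := by
    intro x y z
    rw [← LinearMap.add_apply, ← map_add, ← lie_bracketWedge A hA, act_lie]
    abel
  simp only [jac, map_add, h]
  abel

/-! ### The Jacobi identity for three elements of `⋀⁴ ℂ⁸` -/

/-- The basis vector `e_{a₀} ∧ e_{a₁} ∧ e_{a₂} ∧ e_{a₃}`. -/
def eb (a : Fin 4 → Fin 8) : Wedge4 := exteriorPower.ιMulti ℂ 4 (fun k => Pi.single (a k) 1)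

theorem eb_of_not_injective (a : Fin 4 → Fin 8) (h : ¬ Function.Injective a) : eb a = 0 := by
  simp only [Function.Injective, not_forall] at h
  obtain ⟨i, j, hij, hne⟩ := h
  exact AlternatingMap.map_eq_zero_of_eq _ _ (by simp [hij]) hne

theorem act_single_eb (i j : Fin 8) (a : Fin 4 → Fin 8) :
    act (Matrix.single i j 1) (eb a) = ∑ k, if a k = j then eb (Function.update a k i) else 0 := by
  rw [eb, act_ιMulti]
  refine Finset.sum_congr rfl fun k _ => ?_
  split_ifs with h
  · rw [eb]
    congr 1
    ext l : 1
    by_cases hl : l = k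
    · subst hl
      ext m
      simp [h, Matrix.single_apply, Pi.single_apply, eq_comm]
    · simp [hl]
  · refine AlternatingMap.map_coord_zero _ k ?_
    ext l
    simp [Matrix.single_apply, Matrix.mulVec_single, h, Ne.symm h]

theorem exists_sum_ιMulti_single {n k : ℕ} (x : ⋀[ℂ]^k (Fin n → ℂ)) :
    ∃ r : Set.powersetCard (Fin n) k → ℂ, x = ∑ s, r s • exteriorPower.ιMulti ℂ k
      (fun i => Pi.single (Set.powersetCard.ofFinEmbEquiv.symm s i) 1) := by
  refine ⟨fun s => ((Pi.basisFun ℂ (Fin n)).exteriorPower k).repr x s, ?_⟩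
  conv_lhs => rw [← ((Pi.basisFun ℂ (Fin n)).exteriorPower k).sum_repr x]
  refine Finset.sum_congr rfl fun s _ => ?_
  rw [exteriorPower.basis_apply, exteriorPower.ιMulti_family]
  congr 2
  ext i : 1
  simp

theorem wedge4_basis (x : Wedge4) : ∃ r : Set.powersetCard (Fin 8) 4 → ℂ,
    x = ∑ s, r s • eb (Set.powersetCard.ofFinEmbEquiv.symm s) := exists_sum_ιMulti_single x

theorem eq_top_of_eb_mem (N : Submodule ℂ Wedge4) (s : Fin 4 → Fin 8) (hs : Function.Injective s)
    (h : eb s ∈ N)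
    (hN : ∀ i j, i ∉ Set.range s → j ∈ Set.range s → ∀ x ∈ N, act (Matrix.single i j 1) x ∈ N) :
    N = ⊤ := by
  have key : ∀ n (a : Fin 4 → Fin 8), Function.Injective a →
      (Finset.univ.filter fun p => a p ∉ Set.range s).card = n → eb a ∈ N := by
    intro n
    induction n with
    | zero =>
      intro a ha hn
      have h1 : ∀ p, ∃ q, s q = a p := by
        simpa [Finset.filter_eq_empty_iff] using hn
      choose π hπ using h1
      have hinj : Function.Injective π := fun p q hpq => ha (by rw [← hπ, ← hπ, hpq])
      let σ : Equiv.Perm (Fin 4) := Equiv.ofBijective π (Finite.injective_iff_bijective.mp hinj)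
      have : eb a = Equiv.Perm.sign σ • eb s := by
        rw [eb, eb, ← AlternatingMap.map_perm]
        congr 1
        ext k : 1
        simp [σ, hπ]
      rw [this, Units.smul_def]
      exact N.smul_of_tower_mem _ h
    | succ n ih =>
      intro a ha hn
      obtain ⟨p, hp⟩ := Finset.card_pos.mp (by rw [hn]; omega : 0 < (Finset.univ.filter fun p => a p ∉ Set.range s).card)
      simp only [Finset.mem_filter, Finset.mem_univ, true_and] at hp
      have hq : ∃ q, s q ∉ Set.range a := by
        by_contra! hcon
        have h2 : Finset.univ.image s ⊆ Finset.univ.image a := by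
          intro x hx
          simp only [Finset.mem_image, Finset.mem_univ, true_and] at hx
          obtain ⟨q, rfl⟩ := hx
          simpa using hcon q
        have h3 := Finset.eq_of_subset_of_card_le h2
          (by rw [Finset.card_image_of_injective _ hs, Finset.card_image_of_injective _ ha])
        have : a p ∈ Finset.univ.image a := by simp
        rw [← h3] at this
        exact hp (by simpa using this)
      obtain ⟨q, hq⟩ := hq
      have hq' : ∀ k, a k ≠ s q := fun k hk => hq ⟨k, hk⟩
      have ha' : Function.Injective (Function.update a p (s q)) := by
        intro k l hkl
        by_cases hk : k = p <;> by_cases hl : l = p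
        · rw [hk, hl]
        · subst hk; simp [hl] at hkl; exact absurd hkl.symm (hq' l)
        · subst hl; simp [hk] at hkl; exact absurd hkl (hq' k)
        · simp [hk, hl] at hkl; exact ha hkl
      have hcard : (Finset.univ.filter fun k => Function.update a p (s q) k ∉ Set.range s).card = n := by
        have : (Finset.univ.filter fun k => Function.update a p (s q) k ∉ Set.range s) =
            (Finset.univ.filter fun k => a k ∉ Set.range s).erase p := by
          ext k
          by_cases hk : k = p
          · subst hk; simp
          · simp [hk]
        rw [this, Finset.card_erase_of_mem (by simpa using hp), hn]; rfl
      have hmem := hN (a p) (s q) hp ⟨q, rfl⟩ _ (ih _ ha' hcard)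
      rw [act_single_eb, Finset.sum_eq_single p] at hmem
      · simpa using hmem
      · intro k _ hk
        simp [hk, hq' k]
      · simp
  refine eq_top_iff.mpr fun x _ => ?_
  obtain ⟨r, rfl⟩ := wedge4_basis x
  exact N.sum_mem fun t _ => N.smul_mem _ (key _ _ (RelEmbedding.injective _) rfl)

theorem wedgePairing_act_bracketWedge (u v w z : Wedge4) :
    wedgePairing (act (bracketWedge u v) w) z =
      (∑ i, ∑ j, wedgePairing (act (Matrix.single j i 1) u) v *
        wedgePairing (act (Matrix.single i j 1) w) z) - 2 * wedgePairing u v * wedgePairing w z := by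
  rw [bracketWedge_apply, map_sub, LinearMap.sub_apply, map_smul, LinearMap.smul_apply, act_one,
    map_sub, LinearMap.sub_apply, map_smul, map_smul, LinearMap.smul_apply, LinearMap.smul_apply]
  congr 1
  · conv_lhs => rw [Matrix.matrix_eq_sum_single (Matrix.of _)]
    simp only [map_sum, LinearMap.sum_apply, Matrix.of_apply]
    refine Finset.sum_congr rfl fun i _ => Finset.sum_congr rfl fun j _ => ?_
    have : ∀ c : ℂ, Matrix.single i j c = c • Matrix.single i j (1 : ℂ) := by simp
    rw [this]
    simp only [map_smul, LinearMap.smul_apply, smul_eq_mul]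
  · simp only [smul_eq_mul]; ring

/-- The sign of `b - a`. -/
def sgPair (a b : ℕ) : ℤ := bif Nat.blt a b then 1 else bif Nat.blt b a then -1 else 0

/-- The sign of a map `Fin 8 → Fin 8`, zero if it is not injective. -/
def sg (f : Fin 8 → Fin 8) : ℤ := ∏ i, ∏ j, if i < j then sgPair (f i) (f j) else 1

theorem detRow_single {n : Type} [Fintype n] [DecidableEq n] :
    Matrix.detRowAlternating (fun k => Pi.single k 1 : n → n → ℂ) = 1 := by
  have : (fun k => Pi.single k 1 : n → n → ℂ) = (1 : Matrix n n ℂ) := by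
    ext i j; simp [Matrix.one_apply, Pi.single_apply, eq_comm]
  rw [this]
  exact Matrix.det_one

theorem det8_single (f : Fin 8 → Fin 8) : det8 (fun k => Pi.single (f k) 1) = (sg f : ℂ) := by
  by_cases h : Function.Injective f
  · let σ : Equiv.Perm (Fin 8) := Equiv.ofBijective f (Finite.injective_iff_bijective.mp h)
    have h1 : (fun k => Pi.single (f k) 1 : Fin 8 → V) = (fun k => Pi.single k 1 : Fin 8 → V) ∘ σ := by
      ext k : 1; simp [σ]
    have h2 : det8 (fun k => Pi.single k 1 : Fin 8 → V) = 1 := by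
      have := detRow_single (n := Fin 8)
      rw [← det8] at this
      convert this
    have h3 : sg f = (Equiv.Perm.sign σ : ℤˣ) := by
      rw [Equiv.Perm.sign_eq_prod_prod_Ioi, sg]
      push_cast
      refine Finset.prod_congr rfl fun i _ => ?_
      rw [← Finset.prod_filter]
      refine Finset.prod_congr (by ext; simp) fun j hj => ?_
      have hij : i < j := by simpa using hj
      have hne : f i ≠ f j := fun hh => hij.ne (h hh)
      rcases lt_or_gt_of_ne hne with hlt | hlt
      · have h4 : Nat.blt (f i) (f j) = true := by simpa [Nat.blt_eq] using hlt
        simp [σ, hlt, sgPair, h4]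
      · have h4 : Nat.blt (f j) (f i) = true := by simpa [Nat.blt_eq] using hlt
        have h5 : Nat.blt (f i) (f j) = false := by
          rw [← Bool.not_eq_true, Nat.blt_eq]; exact hlt.le.not_gt
        simp [σ, hlt.le.not_gt, sgPair, h4, h5]
    rw [h1, AlternatingMap.map_perm, h2, h3]
    simp [Units.smul_def]
  · simp only [Function.Injective, not_forall] at h
    obtain ⟨i, j, hij, hne⟩ := h
    have h0 : sg f = 0 := by
      wlog hlt : i < j generalizing i j
      · exact this j i hij.symm (Ne.symm hne) (lt_of_le_of_ne (not_lt.mp hlt) (Ne.symm hne))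
      refine Finset.prod_eq_zero (Finset.mem_univ i) (Finset.prod_eq_zero (Finset.mem_univ j) ?_)
      have h5 : Nat.blt (f j) (f j) = false := by
        rw [← Bool.not_eq_true, Nat.blt_eq]; exact lt_irrefl _
      simp [hlt, sgPair, hij, h5]
    rw [h0, Int.cast_zero]
    exact AlternatingMap.map_eq_zero_of_eq _ _ (by simp [hij]) hne

theorem sg_ne_zero (f : Fin 8 → Fin 8) (h : Function.Injective f) : sg f ≠ 0 := by
  refine Finset.prod_ne_zero_iff.mpr fun i _ => Finset.prod_ne_zero_iff.mpr fun j _ => ?_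
  split_ifs with hij
  · have hne : f i ≠ f j := fun hh => hij.ne (h hh)
    rcases lt_or_gt_of_ne hne with hlt | hlt
    · have h4 : Nat.blt (f i) (f j) = true := by simpa [Nat.blt_eq] using hlt
      simp [sgPair, h4]
    · have h4 : Nat.blt (f j) (f i) = true := by simpa [Nat.blt_eq] using hlt
      have h5 : Nat.blt (f i) (f j) = false := by
        rw [← Bool.not_eq_true, Nat.blt_eq]; exact hlt.le.not_gt
      simp [sgPair, h4, h5]
  · exact one_ne_zero

theorem sg_eq_zero (f : Fin 8 → Fin 8) (h : ¬ Function.Injective f) : sg f = 0 := by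
  simp only [Function.Injective, not_forall] at h
  obtain ⟨i, j, hij, hne⟩ := h
  have : det8 (fun k => Pi.single (f k) 1 : Fin 8 → V) = 0 :=
    AlternatingMap.map_eq_zero_of_eq _ _ (by simp [hij]) hne
  rw [det8_single] at this
  exact_mod_cast this

theorem wedgePairing_eb (a b : Fin 4 → Fin 8) : wedgePairing (eb a) (eb b) = (sg (app a b) : ℂ) := by
  rw [eb, eb, wedgePairing_ιMulti, ← det8_single]
  congr 1
  ext k : 1
  fin_cases k <;> rfl

/-- The value of `⟨[[e_a, e_b], e_c], e_d⟩`. -/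
def quartic (a b c d : Fin 4 → Fin 8) : ℤ :=
  (∑ p, ∑ q, sg (app (Function.update a p (c q)) b) * sg (app (Function.update c q (a p)) d)) -
    2 * sg (app a b) * sg (app c d)

theorem wedgePairing_act_bracketWedge_eb (a b c d : Fin 4 → Fin 8) :
    wedgePairing (act (bracketWedge (eb a) (eb b)) (eb c)) (eb d) = (quartic a b c d : ℂ) := by
  rw [wedgePairing_act_bracketWedge, quartic]
  simp only [act_single_eb, map_sum, LinearMap.sum_apply, wedgePairing_eb]
  push_cast
  congr 1
  have h1 : ∀ (P : Prop) [Decidable P] (x y : Wedge4), wedgePairing (if P then x else 0) y =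
      if P then wedgePairing x y else 0 := by
    intro P _ x y; split_ifs <;> simp
  simp only [h1, wedgePairing_eb, Finset.sum_mul_sum]
  rw [Finset.sum_comm' (t' := Finset.univ) (s' := fun _ => Finset.univ) (by simp)]
  rw [show (∑ y : Fin 8, ∑ x : Fin 8, ∑ i : Fin 4, ∑ j : Fin 4,
      (if a i = x then ((sg (app (Function.update a i y) b) : ℤ) : ℂ) else 0) *
        (if c j = y then ((sg (app (Function.update c j x) d) : ℤ) : ℂ) else 0)) =
      ∑ i : Fin 4, ∑ j : Fin 4, ∑ y : Fin 8, ∑ x : Fin 8,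
      (if a i = x then ((sg (app (Function.update a i y) b) : ℤ) : ℂ) else 0) *
        (if c j = y then ((sg (app (Function.update c j x) d) : ℤ) : ℂ) else 0) from ?_]
  · refine Finset.sum_congr rfl fun i _ => Finset.sum_congr rfl fun j _ => ?_
    rw [Finset.sum_eq_single (c j), Finset.sum_eq_single (a i)]
    · simp
    · intro x _ hx; simp [Ne.symm hx]
    · simp
    · intro y _ hy; simp [Ne.symm hy]
    · simp
  · have h2 : ∀ F : Fin 8 → Fin 8 → Fin 4 → Fin 4 → ℂ,
        (∑ y, ∑ x, ∑ i, ∑ j, F y x i j) = ∑ i, ∑ j, ∑ y, ∑ x, F y x i j := by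
      intro F
      refine (Finset.sum_congr rfl fun y _ => Finset.sum_comm).trans (Finset.sum_comm.trans ?_)
      exact Finset.sum_congr rfl fun i _ =>
        (Finset.sum_congr rfl fun y _ => Finset.sum_comm).trans Finset.sum_comm
    exact h2 _

theorem eq_zero_of_wedgePairing (x : Wedge4)
    (h : ∀ d : Fin 4 → Fin 8, StrictMono d → wedgePairing x (eb d) = 0) : x = 0 := by
  obtain ⟨r, rfl⟩ := wedge4_basis x
  refine Finset.sum_eq_zero fun s _ => ?_
  have hc : (s : Finset (Fin 8))ᶜ ∈ Set.powersetCard (Fin 8) 4 := by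
    have := s.2
    simp only [Set.powersetCard.mem_iff] at this ⊢
    rw [Finset.card_compl, this]; rfl
  have hmem : ∀ (t : Set.powersetCard (Fin 8) 4) (y : Fin 8),
      (∃ k, Set.powersetCard.ofFinEmbEquiv.symm t k = y) ↔ y ∈ (t : Finset (Fin 8)) := fun t y =>
    Set.powersetCard.mem_range_ofFinEmbEquiv_symm_iff_mem t y
  have h1 := h (Set.powersetCard.ofFinEmbEquiv.symm ⟨_, hc⟩) (OrderEmbedding.strictMono _)
  rw [map_sum, LinearMap.sum_apply, Finset.sum_eq_single s] at h1
  · rw [map_smul, LinearMap.smul_apply, wedgePairing_eb, smul_eq_mul] at h1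
    have h2 : sg (app (Set.powersetCard.ofFinEmbEquiv.symm s)
        (Set.powersetCard.ofFinEmbEquiv.symm ⟨_, hc⟩)) ≠ 0 := by
      refine sg_ne_zero _ ?_
      refine Fin.append_injective_iff.mpr ⟨RelEmbedding.injective _, RelEmbedding.injective _, ?_⟩
      intro i j hij
      have h3 := (hmem s _).mp ⟨i, rfl⟩
      rw [hij] at h3
      have h4 := (hmem ⟨_, hc⟩ _).mp ⟨j, rfl⟩
      exact (Finset.mem_compl.mp h4) h3
    have h3 : r s = 0 := by
      rcases mul_eq_zero.mp h1 with h | h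
      · exact h
      · exact absurd (by exact_mod_cast h) h2
    rw [h3, zero_smul]
  · intro t _ hts
    rw [map_smul, LinearMap.smul_apply, wedgePairing_eb, sg_eq_zero, Int.cast_zero, smul_zero]
    intro hinj
    obtain ⟨y, hyt, hys⟩ := (Set.powersetCard.exists_mem_notMem_iff_ne t s).mp hts
    obtain ⟨i, hi⟩ := (hmem t y).mpr hyt
    obtain ⟨j, hj⟩ := (hmem ⟨_, hc⟩ y).mpr (Finset.mem_compl.mpr hys)
    exact (Fin.append_injective_iff.mp hinj).2.2 i j (hi.trans hj.symm)
  · simp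

def sgRow (x : ℕ) (l : List ℕ) (k : ℤ) : ℤ :=
  l.foldr (fun y acc => bif Nat.blt x y then acc else bif Nat.blt y x then -acc else 0) k
def sgList (l : List ℕ) (k : ℤ) : ℤ :=
  List.rec (motive := fun _ => ℤ) k (fun x t ih => sgRow x t ih) l
def mulz (x y : ℤ) : ℤ := bif Nat.beq x.natAbs 0 then 0 else x * y
def term (a b c d : List ℕ) (p q : ℕ) : ℤ :=
  mulz (sgList (a.set p (c.getD q 0) ++ b) 1) (sgList (c.set q (a.getD p 0) ++ d) 1)
def quarticList (a b c d : List ℕ) : ℤ :=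
  (term a b c d 0 0 + term a b c d 0 1 + term a b c d 0 2 + term a b c d 0 3) +
  (term a b c d 1 0 + term a b c d 1 1 + term a b c d 1 2 + term a b c d 1 3) +
  (term a b c d 2 0 + term a b c d 2 1 + term a b c d 2 2 + term a b c d 2 3) +
  (term a b c d 3 0 + term a b c d 3 1 + term a b c d 3 2 + term a b c d 3 3)
  - 2 * mulz (sgList (a ++ b) 1) (sgList (c ++ d) 1)
def quads : List (List ℕ) := [[0, 1, 2, 3], [0, 1, 2, 4], [0, 1, 2, 5], [0, 1, 2, 6], [0, 1, 2, 7], [0, 1, 3, 4], [0, 1, 3, 5], [0, 1, 3, 6], [0, 1, 3, 7], [0, 1, 4, 5], [0, 1, 4, 6], [0, 1, 4, 7], [0, 1, 5, 6], [0, 1, 5, 7], [0, 1, 6, 7], [0, 2, 3, 4], [0, 2, 3, 5], [0, 2, 3, 6], [0, 2, 3, 7], [0, 2, 4, 5], [0, 2, 4, 6], [0, 2, 4, 7], [0, 2, 5, 6], [0, 2, 5, 7], [0, 2, 6, 7], [0, 3, 4, 5], [0, 3, 4, 6], [0, 3, 4, 7], [0, 3, 5, 6], [0, 3, 5, 7],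 [0, 3, 6, 7], [0, 4, 5, 6], [0, 4, 5, 7], [0, 4, 6, 7], [0, 5, 6, 7], [1, 2, 3, 4], [1, 2, 3, 5], [1, 2, 3, 6], [1, 2, 3, 7], [1, 2, 4, 5], [1, 2, 4, 6], [1, 2, 4, 7], [1, 2, 5, 6], [1, 2, 5, 7], [1, 2, 6, 7], [1, 3, 4, 5], [1, 3, 4, 6], [1, 3, 4, 7], [1, 3, 5, 6], [1, 3, 5, 7], [1, 3, 6, 7], [1, 4, 5, 6], [1, 4, 5, 7], [1, 4, 6, 7], [1, 5, 6, 7], [2, 3, 4, 5], [2, 3, 4, 6], [2, 3, 4, 7], [2, 3, 5, 6], [2, 3, 5, 7], [2, 3, 6, 7], [2, 4, 5, 6], [2, 4, 5, 7], [2, 4, 6, 7], [2, 5, 6, 7], [3, 4, 5, 6], [3, 4, 5, 7], [3, 4, 6, 7], [3, 5, 6, 7], [4, 5, 6, 7]]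
theorem quads_check : ∀ c ∈ quads, ∀ d ∈ quads, (∀ x ∈ c, x ∉ d) →
   quarticList [0,1,2,3] [4,5,6,7] c d + quarticList [4,5,6,7] c [0,1,2,3] d + quarticList c [0,1,2,3] [4,5,6,7] d = 0 := by
  decide +kernel

theorem sgRow_eq (x : ℕ) (l : List ℕ) (k : ℤ) : sgRow x l k = (l.map (sgPair x)).prod * k := by
  induction l with
  | nil => simp [sgRow]
  | cons y t ih =>
    have : sgRow x (y :: t) k =
      bif Nat.blt x y then sgRow x t k else bif Nat.blt y x then -sgRow x t k else 0 := rfl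
    rw [this, ih, List.map_cons, List.prod_cons, sgPair]
    cases Nat.blt x y <;> cases Nat.blt y x <;> simp

theorem sgList_cons (x : ℕ) (l : List ℕ) (k : ℤ) : sgList (x :: l) k = sgRow x l (sgList l k) := rfl

theorem sgList_nil (k : ℤ) : sgList [] k = k := rfl

theorem sg_eq_sgList (f : Fin 8 → Fin 8) :
    sg f = sgList [(f 0 : ℕ), f 1, f 2, f 3, f 4, f 5, f 6, f 7] 1 := by
  simp [sg, sgList_cons, sgList_nil, sgRow_eq, Fin.prod_univ_eight]
  ring

theorem mulz_eq (x y : ℤ) : mulz x y = x * y := by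
  unfold mulz
  cases h : Nat.beq x.natAbs 0
  · rfl
  · have : x = 0 := by simpa using h
    simp [this]

def quadList (a : Fin 4 → Fin 8) : List ℕ := [(a 0 : ℕ), a 1, a 2, a 3]

theorem sg_app (a b : Fin 4 → Fin 8) :
    sg (app a b) = sgList (quadList a ++ quadList b) 1 := by
  rw [sg_eq_sgList]; rfl

theorem quadList_update (a : Fin 4 → Fin 8) (p : Fin 4) (x : Fin 8) :
    quadList (Function.update a p x) = (quadList a).set p x := by
  fin_cases p <;> rfl

theorem quadList_getD (a : Fin 4 → Fin 8) (p : Fin 4) :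
    (quadList a).getD p 0 = a p := by
  fin_cases p <;> rfl

theorem quartic_eq (a b c d : Fin 4 → Fin 8) :
    quartic a b c d = quarticList (quadList a) (quadList b) (quadList c) (quadList d) := by
  have h : ∀ p q : Fin 4, sg (app (Function.update a p (c q)) b) *
      sg (app (Function.update c q (a p)) d) =
      term (quadList a) (quadList b) (quadList c) (quadList d) p q := by
    intro p q
    rw [term, mulz_eq, sg_app, sg_app, quadList_update, quadList_update, quadList_getD,
      quadList_getD]
  simp only [quartic, h, Fin.sum_univ_four]
  simp only [quarticList, mulz_eq, sg_app, mul_assoc]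
  rfl

theorem quadList_mem (c : Fin 4 → Fin 8) (hc : StrictMono c) : quadList c ∈ quads := by
  have key : ∀ c0 c1 : Fin 8, c0 < c1 → ∀ c2, c1 < c2 → ∀ c3, c2 < c3 →
      [(c0 : ℕ), c1, c2, c3] ∈ quads := by decide +kernel
  exact key _ _ (hc (by decide)) _ (hc (by decide)) _ (hc (by decide))

theorem act_single_diag (i : Fin 8) (a : Fin 4 → Fin 8) (ha : Function.Injective a) :
    act (Matrix.single i i 1) (eb a) = (if i ∈ Set.range a then (1 : ℂ) else 0) • eb a := by
  rw [act_single_eb]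
  split_ifs with h
  · obtain ⟨k, rfl⟩ := h
    rw [Finset.sum_eq_single k]
    · simp
    · intro l _ hl
      rw [if_neg]
      exact fun hh => hl (ha hh)
    · simp
  · rw [zero_smul]
    refine Finset.sum_eq_zero fun k _ => ?_
    rw [if_neg]
    exact fun hh => h ⟨k, hh⟩

def lo : Fin 4 → Fin 8 := ![0, 1, 2, 3]
def hi : Fin 4 → Fin 8 := ![4, 5, 6, 7]

theorem lo_injective : Function.Injective lo := by decide
theorem hi_injective : Function.Injective hi := by decide

theorem jac_add_left (x y v w : Wedge4) : jac (x + y) v w = jac x v w + jac y v w := by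
  simp only [jac, map_add, LinearMap.add_apply]; abel

theorem jac_add_mid (u x y w : Wedge4) : jac u (x + y) w = jac u x w + jac u y w := by
  simp only [jac, map_add, LinearMap.add_apply]; abel

theorem jac_add_right (u v x y : Wedge4) : jac u v (x + y) = jac u v x + jac u v y := by
  simp only [jac, map_add, LinearMap.add_apply]; abel

theorem jac_sub_left (x y v w : Wedge4) : jac (x - y) v w = jac x v w - jac y v w := by
  simp only [jac, map_sub, LinearMap.sub_apply]; abel

theorem jac_sub_mid (u x y w : Wedge4) : jac u (x - y) w = jac u x w - jac u y w := by
  simp only [jac, map_sub, LinearMap.sub_apply]; abel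

theorem jac_sub_right (u v x y : Wedge4) : jac u v (x - y) = jac u v x - jac u v y := by
  simp only [jac, map_sub, LinearMap.sub_apply]; abel

theorem jac_smul_left (r : ℂ) (u v w : Wedge4) : jac (r • u) v w = r • jac u v w := by
  simp only [jac, map_smul, LinearMap.smul_apply, smul_add]

theorem jac_smul_mid (r : ℂ) (u v w : Wedge4) : jac u (r • v) w = r • jac u v w := by
  simp only [jac, map_smul, LinearMap.smul_apply, smul_add]

theorem jac_smul_right (r : ℂ) (u v w : Wedge4) : jac u v (r • w) = r • jac u v w := by
  simp only [jac, map_smul, LinearMap.smul_apply, smul_add]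

theorem jac_zero_left (v w : Wedge4) : jac 0 v w = 0 := by
  simpa using jac_smul_left 0 0 v w

theorem jac_zero_mid (v w : Wedge4) : jac v 0 w = 0 := by
  simpa using jac_smul_mid 0 v 0 w

theorem wedgePairing_jac_lo_hi (c d : Fin 4 → Fin 8) (hc : StrictMono c) (hd : StrictMono d) :
    wedgePairing (jac (eb lo) (eb hi) (eb c)) (eb d) = 0 := by
  by_cases hcd : ∃ i, i ∈ Set.range c ∧ i ∈ Set.range d
  · obtain ⟨i, hic, hid⟩ := hcd
    have hj : ∃ j, j ∉ Set.range c ∧ j ∉ Set.range d := by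
      by_contra! hcon
      have hu : Finset.univ.image c ∪ Finset.univ.image d = Finset.univ := by
        ext y
        simp only [Finset.mem_union, Finset.mem_image, Finset.mem_univ, true_and, iff_true]
        by_cases hy : y ∈ Set.range c
        · exact Or.inl hy
        · exact Or.inr (hcon y hy)
      have h1 := Finset.card_union_add_card_inter (Finset.univ.image c) (Finset.univ.image d)
      rw [hu, Finset.card_image_of_injective _ hc.injective,
        Finset.card_image_of_injective _ hd.injective] at h1
      have h2 : 0 < (Finset.univ.image c ∩ Finset.univ.image d).card :=
        Finset.card_pos.mpr ⟨i, by simpa using ⟨hic, hid⟩⟩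
      rw [Finset.card_univ, Finset.card_univ, Fintype.card_fin, Fintype.card_fin] at h1
      omega
    obtain ⟨j, hjc, hjd⟩ := hj
    have hlh : ∀ k : Fin 8, ((if k ∈ Set.range lo then (1 : ℂ) else 0) +
        if k ∈ Set.range hi then (1 : ℂ) else 0) = 1 := by
      intro k
      fin_cases k <;> simp [lo, hi]
    have htr : (Matrix.single i i (1 : ℂ) - Matrix.single j j 1).trace = 0 := by
      simp [Matrix.trace_sub]
    have h1 := wedgePairing_act (Matrix.single i i 1 - Matrix.single j j 1)
      (jac (eb lo) (eb hi) (eb c)) (eb d)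
    rw [act_jac _ htr, htr] at h1
    simp only [map_sub, LinearMap.sub_apply, act_single_diag _ _ lo_injective,
      act_single_diag _ _ hi_injective, act_single_diag _ _ hc.injective,
      act_single_diag _ _ hd.injective] at h1
    simp only [jac_sub_left, jac_sub_mid, jac_sub_right, map_sub, LinearMap.sub_apply, jac_smul_left, jac_smul_mid, jac_smul_right,
      map_add, map_smul, LinearMap.add_apply, LinearMap.smul_apply, smul_eq_mul, if_pos hic,
      if_pos hid, if_neg hjc, if_neg hjd] at h1
    linear_combination h1 / 2 - (hlh i - hlh j) / 2 *
      wedgePairing (jac (eb lo) (eb hi) (eb c)) (eb d)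
  · rw [jac, map_add, map_add, LinearMap.add_apply, LinearMap.add_apply,
      wedgePairing_act_bracketWedge_eb, wedgePairing_act_bracketWedge_eb,
      wedgePairing_act_bracketWedge_eb, quartic_eq, quartic_eq, quartic_eq]
    have h := quads_check _ (quadList_mem c hc) _ (quadList_mem d hd) (by
      intro x hx hx'
      have h1 : ∀ a : Fin 4 → Fin 8, x ∈ quadList a → ∃ k, (a k : ℕ) = x := by
        intro a ha
        simp only [quadList, List.mem_cons, List.not_mem_nil, or_false] at ha
        rcases ha with h | h | h | h <;> exact ⟨_, h.symm⟩
      obtain ⟨k, hk⟩ := h1 c hx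
      obtain ⟨l, hl⟩ := h1 d hx'
      exact hcd ⟨c k, ⟨k, rfl⟩, ⟨l, Fin.ext (hl.trans hk.symm)⟩⟩)
    exact_mod_cast h

theorem jac_eq_zero (u v w : Wedge4) : jac u v w = 0 := by
  have h1 : ∀ w, jac (eb lo) (eb hi) w = 0 := by
    intro w
    let N0 : Submodule ℂ Wedge4 :=
      { carrier := {w | jac (eb lo) (eb hi) w = 0}
        add_mem' := fun {x y} hx hy => (jac_add_right _ _ x y).trans (by
          rw [Set.mem_ofPred_eq.mp hx, Set.mem_ofPred_eq.mp hy, add_zero])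
        zero_mem' := by simpa using jac_smul_right 0 (eb lo) (eb hi) 0
        smul_mem' := fun r x hx => (jac_smul_right r _ _ x).trans (by
          rw [Set.mem_ofPred_eq.mp hx, smul_zero]) }
    obtain ⟨r, rfl⟩ := wedge4_basis w
    exact N0.sum_mem fun s _ => N0.smul_mem _ (eq_zero_of_wedgePairing _ fun d hd =>
      wedgePairing_jac_lo_hi _ d (OrderEmbedding.strictMono _) hd)
  have htr : ∀ i j : Fin 8, i ≠ j → (Matrix.single i j (1 : ℂ)).trace = 0 := fun i j h =>
    Matrix.trace_single_eq_of_ne i j 1 h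
  let N1 : Submodule ℂ Wedge4 :=
    { carrier := {v | ∀ w, jac (eb lo) v w = 0}
      add_mem' := fun {x y} hx hy w => by rw [jac_add_mid, hx w, hy w, add_zero]
      zero_mem' := fun w => jac_zero_mid _ w
      smul_mem' := fun r x hx w => by
        rw [jac_smul_mid, hx w, smul_zero] }
  have h2 : N1 = ⊤ := by
    refine eq_top_of_eb_mem N1 hi hi_injective h1 ?_
    intro i j hi' hj' x hx w
    have hij : i ≠ j := fun h => hi' (h ▸ hj')
    have hact : act (Matrix.single i j 1) (eb lo) = 0 := by
      rw [act_single_eb]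
      refine Finset.sum_eq_zero fun k _ => ?_
      rw [if_neg]
      intro h
      rw [← h] at hj'
      revert hj'
      fin_cases k <;> simp [lo, hi]
    have h3 := act_jac _ (htr i j hij) (eb lo) x w
    rw [hx w, map_zero, hact, jac_zero_left, hx, zero_add, add_zero] at h3
    exact h3.symm
  have h4 : ∀ v w, jac (eb lo) v w = 0 := by
    intro v
    have : v ∈ N1 := h2 ▸ Submodule.mem_top
    exact this
  let N2 : Submodule ℂ Wedge4 :=
    { carrier := {u | ∀ v w, jac u v w = 0}
      add_mem' := fun {x y} hx hy v w => by rw [jac_add_left, hx v w, hy v w, add_zero]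
      zero_mem' := jac_zero_left
      smul_mem' := fun r x hx v w => by
        rw [jac_smul_left, hx v w, smul_zero] }
  have h5 : N2 = ⊤ := by
    refine eq_top_of_eb_mem N2 lo lo_injective h4 ?_
    intro i j hi' hj' x hx v w
    have hij : i ≠ j := fun h => hi' (h ▸ hj')
    have h3 := act_jac _ (htr i j hij) x v w
    rw [hx v w, map_zero, hx, hx, add_zero, add_zero] at h3
    exact h3.symm
  have : u ∈ N2 := h5 ▸ Submodule.mem_top
  exact this v w

/-! ### The Lie algebra of type `E₇` -/

/-- The complex simple Lie algebra of type `E₇` in its standard model `𝔤 = 𝔤₀ ⊕ 𝔤₁` with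
`𝔤₀ = 𝔰𝔩(8, ℂ)` and `𝔤₁ = ⋀⁴ ℂ⁸`. -/
def E7 : Type := LieAlgebra.SpecialLinear.sl (Fin 8) ℂ × Wedge4

namespace E7

instance : AddCommGroup E7 :=
  inferInstanceAs (AddCommGroup (LieAlgebra.SpecialLinear.sl (Fin 8) ℂ × Wedge4))

instance : Module ℂ E7 :=
  inferInstanceAs (Module ℂ (LieAlgebra.SpecialLinear.sl (Fin 8) ℂ × Wedge4))

/-- `⁅(A, u), (B, v)⁆ = (⁅A, B⁆ + [u, v], A · v - B · u)`. -/
instance : Bracket E7 E7 where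
  bracket x y :=
    (⁅x.1, y.1⁆ + ⟨bracketWedge x.2 y.2, LinearMap.mem_ker.2 (trace_bracketWedge x.2 y.2)⟩,
      act x.1 y.2 - act y.1 x.2)

theorem ext' {x y : E7} (h1 : (x.1 : Matrix (Fin 8) (Fin 8) ℂ) = y.1) (h2 : x.2 = y.2) : x = y :=
  Prod.ext (Subtype.ext h1) h2

theorem add_fst (x y : E7) : ((x + y).1 : Matrix (Fin 8) (Fin 8) ℂ) = x.1 + y.1 := rfl
theorem add_snd (x y : E7) : (x + y).2 = x.2 + y.2 := rfl
theorem smul_fst (c : ℂ) (x : E7) : ((c • x).1 : Matrix (Fin 8) (Fin 8) ℂ) = c • x.1 := rfl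
theorem smul_snd (c : ℂ) (x : E7) : (c • x).2 = c • x.2 := rfl
theorem zero_fst : ((0 : E7).1 : Matrix (Fin 8) (Fin 8) ℂ) = 0 := rfl
theorem zero_snd : (0 : E7).2 = 0 := rfl
theorem lie_fst (x y : E7) : (⁅x, y⁆.1 : Matrix (Fin 8) (Fin 8) ℂ) =
    (x.1 * y.1 - y.1 * x.1 : Matrix (Fin 8) (Fin 8) ℂ) + bracketWedge x.2 y.2 := rfl
theorem lie_snd (x y : E7) : ⁅x, y⁆.2 = act x.1 y.2 - act y.1 x.2 := rfl
theorem trace_fst (x : E7) : (x.1 : Matrix (Fin 8) (Fin 8) ℂ).trace = 0 :=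
  LinearMap.mem_ker.1 x.1.2

instance : LieRing E7 where
  add_lie x y z := by
    refine ext' ?_ ?_
    · simp only [lie_fst, add_fst, add_snd, map_add, LinearMap.add_apply]
      noncomm_ring
    · simp only [lie_snd, add_fst, add_snd, map_add, LinearMap.add_apply]
      abel
  lie_add x y z := by
    refine ext' ?_ ?_
    · simp only [lie_fst, add_fst, add_snd, map_add]
      noncomm_ring
    · simp only [lie_snd, add_fst, add_snd, map_add, LinearMap.add_apply]
      abel
  lie_self x := by
    refine ext' ?_ ?_
    · rw [lie_fst, bracketWedge_self, sub_self, add_zero]; rfl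
    · rw [lie_snd, sub_self]; rfl
  leibniz_lie x y z := by
    refine ext' ?_ ?_
    · have h1 := lie_bracketWedge x.1 (trace_fst x) y.2 z.2
      have h2 := lie_bracketWedge y.1 (trace_fst y) x.2 z.2
      have h3 := lie_bracketWedge z.1 (trace_fst z) x.2 y.2
      have h4 := bracketWedge_swap (act z.1 x.2) y.2
      simp only [lie_fst, lie_snd, add_fst, map_sub, LinearMap.sub_apply]
      linear_combination (norm := noncomm_ring) h1 - h2 + h3 + h4
    · have hj := jac_eq_zero x.2 y.2 z.2
      simp only [jac] at hj
      rw [bracketWedge_swap x.2 z.2] at hj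
      rw [map_neg, LinearMap.neg_apply] at hj
      simp only [lie_fst, lie_snd, add_snd, map_add, LinearMap.add_apply, act_lie]
      simp only [map_sub]
      linear_combination (norm := abel) -hj

instance : LieAlgebra ℂ E7 where
  lie_smul c x y := by
    refine ext' ?_ ?_
    · simp only [lie_fst, smul_fst, smul_snd, map_smul, smul_add, smul_sub, Matrix.mul_smul,
        Matrix.smul_mul]
    · simp only [lie_snd, smul_fst, smul_snd, map_smul, smul_sub, LinearMap.smul_apply]

/-- The summand `𝔤₀ = 𝔰𝔩(8, ℂ)`. -/
def gZero : Submodule ℂ E7 := LinearMap.ker (LinearMap.snd ℂ _ _)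

/-- The summand `𝔤₁ = ⋀⁴ ℂ⁸`. -/
def gOne : Submodule ℂ E7 := LinearMap.ker (LinearMap.fst ℂ _ _)

end E7

/-! ### Group actions and complex conjugation -/

/-- The group `SL(8, ℂ)`. -/
abbrev SL8C : Type := Matrix.SpecialLinearGroup (Fin 8) ℂ
/-- The group `SL(8, ℝ)`. -/
abbrev SL8R : Type := Matrix.SpecialLinearGroup (Fin 8) ℝ

/-- `SL(8, ℂ)` acts on `𝔤₀` by conjugation and on `𝔤₁ = ⋀⁴ ℂ⁸` by
`g · (v₁ ∧ v₂ ∧ v₃ ∧ v₄) = gv₁ ∧ gv₂ ∧ gv₃ ∧ gv₄`. -/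
instance : MulAction SL8C E7 where
  smul g x :=
    (⟨(g : Matrix (Fin 8) (Fin 8) ℂ) * x.1 * ((g⁻¹ : SL8C) : Matrix (Fin 8) (Fin 8) ℂ), by
      refine LinearMap.mem_ker.2 ?_
      rw [Matrix.traceLinearMap_apply, Matrix.trace_mul_comm, ← Matrix.mul_assoc,
        ← Matrix.SpecialLinearGroup.coe_mul, inv_mul_cancel, Matrix.SpecialLinearGroup.coe_one,
        Matrix.one_mul]
      exact E7.trace_fst x⟩,
    exteriorPower.map 4 (Matrix.toLin' (g : Matrix (Fin 8) (Fin 8) ℂ)) x.2)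
  one_smul x := by
    refine E7.ext' ?_ ?_
    · change (1 : SL8C).1 * x.1.1 * ((1 : SL8C)⁻¹).1 = _
      simp
    · change exteriorPower.map 4 (Matrix.toLin' (1 : SL8C).1) x.2 = _
      simp
  mul_smul g g' x := by
    refine E7.ext' ?_ ?_
    · change (g * g' : SL8C).1 * x.1.1 * ((g * g' : SL8C)⁻¹).1 =
        g.1 * (g'.1 * x.1.1 * (g'⁻¹ : SL8C).1) * (g⁻¹ : SL8C).1
      rw [_root_.mul_inv_rev]
      simp only [Matrix.SpecialLinearGroup.coe_mul, Matrix.mul_assoc]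
    · change exteriorPower.map 4 (Matrix.toLin' (g * g' : SL8C).1) x.2 =
        exteriorPower.map 4 (Matrix.toLin' g.1) (exteriorPower.map 4 (Matrix.toLin' g'.1) x.2)
      rw [Matrix.SpecialLinearGroup.coe_mul, Matrix.toLin'_mul, exteriorPower.map_comp]
      rfl

theorem smul_fst (g : SL8C) (x : E7) : ((g • x).1 : Matrix (Fin 8) (Fin 8) ℂ) =
    (g : Matrix (Fin 8) (Fin 8) ℂ) * x.1 * ((g⁻¹ : SL8C) : Matrix (Fin 8) (Fin 8) ℂ) := rfl

theorem smul_snd (g : SL8C) (x : E7) :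
    (g • x).2 = exteriorPower.map 4 (Matrix.toLin' (g : Matrix (Fin 8) (Fin 8) ℂ)) x.2 := rfl

/-- `SL(8, ℝ)` acts through its inclusion in `SL(8, ℂ)`. -/
instance : MulAction SL8R E7 :=
  MulAction.compHom E7 (Matrix.SpecialLinearGroup.map (algebraMap ℝ ℂ) : SL8R →* SL8C)

/-- Complex conjugation of the coordinates with respect to the standard basis
`e_{i₁} ∧ ⋯ ∧ e_{iₖ}` (`i₁ < ⋯ < iₖ`) of `⋀ᵏ ℂⁿ`. -/
def wedgeConj {n k : ℕ} (x : ⋀[ℂ]^k (Fin n → ℂ)) : ⋀[ℂ]^k (Fin n → ℂ) :=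
  ∑ s, starRingEnd ℂ (((Pi.basisFun ℂ (Fin n)).exteriorPower k).repr x s) •
    (Pi.basisFun ℂ (Fin n)).exteriorPower k s

theorem wedgeConj_add {n k : ℕ} (x y : ⋀[ℂ]^k (Fin n → ℂ)) :
    wedgeConj (x + y) = wedgeConj x + wedgeConj y := by
  simp only [wedgeConj, map_add, Finsupp.add_apply, add_smul, Finset.sum_add_distrib]

theorem wedgeConj_smul {n k : ℕ} (c : ℂ) (x : ⋀[ℂ]^k (Fin n → ℂ)) :
    wedgeConj (c • x) = starRingEnd ℂ c • wedgeConj x := by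
  simp only [wedgeConj, map_smul, Finsupp.smul_apply, smul_eq_mul, map_mul, mul_smul,
    Finset.smul_sum]

theorem wedgeConj_ιMulti {n k : ℕ} (v : Fin k → Fin n → ℂ) :
    wedgeConj (exteriorPower.ιMulti ℂ k v) =
      exteriorPower.ιMulti ℂ k (fun i j => starRingEnd ℂ (v i j)) := by
  conv_rhs => rw [← ((Pi.basisFun ℂ (Fin n)).exteriorPower k).sum_repr
    (exteriorPower.ιMulti ℂ k (fun i j => starRingEnd ℂ (v i j)))]
  refine Finset.sum_congr rfl fun s _ => ?_
  congr 1
  rw [exteriorPower.basis_repr_apply, exteriorPower.basis_repr_apply,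
    exteriorPower.ιMultiDual_apply_ιMulti, exteriorPower.ιMultiDual_apply_ιMulti, RingHom.map_det]
  congr 1

/-- The canonical conjugation `σ` of `𝔤`: it conjugates the matrix entries on `𝔤₀` and the
coordinates on `𝔤₁`. -/
def conj (x : E7) : E7 :=
  (⟨(x.1 : Matrix (Fin 8) (Fin 8) ℂ).map (starRingEnd ℂ), by
    refine LinearMap.mem_ker.2 ?_
    have h := congrArg (starRingEnd ℂ) (E7.trace_fst x)
    rw [map_zero, AddMonoidHom.map_trace] at h
    exact h⟩, wedgeConj x.2)

/-- The real form `𝔤^ℝ = 𝔰𝔩(8, ℝ) ⊕ ⋀⁴ ℝ⁸`, as the set of `σ`-fixed points. -/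
def realForm : Set E7 := {x | conj x = x}

/-- Entrywise complex conjugation on `SL(8, ℂ)`. -/
def conjSL : MulAut SL8C where
  toFun := Matrix.SpecialLinearGroup.map (starRingEnd ℂ)
  invFun := Matrix.SpecialLinearGroup.map (starRingEnd ℂ)
  left_inv g := by ext; simp
  right_inv g := by ext; simp
  map_mul' := map_mul _

theorem conjSL_conjSL (g : SL8C) : conjSL (conjSL g) = g := conjSL.left_inv g

theorem conj_smul (g : SL8C) (x : E7) : conj (g • x) = conjSL g • conj x := by
  refine E7.ext' ?_ ?_
  · rw [smul_fst, ← map_inv]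
    change ((g • x).1 : Matrix (Fin 8) (Fin 8) ℂ).map (starRingEnd ℂ) =
      (g : Matrix (Fin 8) (Fin 8) ℂ).map (starRingEnd ℂ) * (x.1.1).map (starRingEnd ℂ) *
        ((g⁻¹ : SL8C) : Matrix (Fin 8) (Fin 8) ℂ).map (starRingEnd ℂ)
    rw [smul_fst, Matrix.map_mul, Matrix.map_mul]
  · rw [smul_snd]
    change wedgeConj (g • x).2 = exteriorPower.map 4 (Matrix.toLin'
      ((g : Matrix (Fin 8) (Fin 8) ℂ).map (starRingEnd ℂ))) (wedgeConj x.2)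
    rw [smul_snd]
    induction x.2 using wedge4_induction with
    | h0 =>
      have : wedgeConj (0 : Wedge4) = 0 := by simpa using wedgeConj_smul 0 (0 : Wedge4)
      rw [map_zero, this, map_zero]
    | hadd x y hx hy => rw [map_add, wedgeConj_add, wedgeConj_add, map_add, hx, hy]
    | hsmul c x hx => rw [map_smul, wedgeConj_smul, wedgeConj_smul, map_smul, hx]
    | h v =>
      rw [exteriorPower.map_apply_ιMulti, wedgeConj_ιMulti, wedgeConj_ιMulti,
        exteriorPower.map_apply_ιMulti]
      congr 1
      ext i j
      simp [Matrix.mulVec, dotProduct]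

/-! ### Galois cohomology -/

/-- The `1`-cocycles of a group with an involution `σ`. -/
def Cocycle {G : Type} [Group G] (σ : MulAut G) : Type := {c : G // c * σ c = 1}

/-- `c` and `c'` are equivalent if `c' = h c σ(h)⁻¹` for some `h`. -/
def cocycleSetoid {G : Type} [Group G] (σ : MulAut G) : Setoid (Cocycle σ) where
  r c c' := ∃ h : G, c'.1 = h * c.1 * (σ h)⁻¹
  iseqv :=
    { refl := fun c => ⟨1, by simp⟩
      symm := by
        rintro c c' ⟨h, hh⟩
        exact ⟨h⁻¹, by rw [hh, map_inv]; group⟩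
      trans := by
        rintro c c' c'' ⟨h, hh⟩ ⟨k, hk⟩
        exact ⟨k * h, by rw [hk, hh, map_mul]; group⟩ }

/-- The first Galois cohomology set `H¹(G, σ)`. -/
def H1 {G : Type} [Group G] (σ : MulAut G) : Type := Quotient (cocycleSetoid σ)

/-- The class of a cocycle. -/
def Cocycle.toH1 {G : Type} [Group G] {σ : MulAut G} (c : Cocycle σ) : H1 σ :=
  Quotient.mk (cocycleSetoid σ) c

/-! ### Homogeneous `𝔰𝔩₂`-triples -/

/-- `(h, e, f)` is an `𝔰𝔩₂`-triple with `h ∈ 𝔤₀` and `e, f ∈ 𝔤₁`. The zero triple is allowed. -/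
structure IsHomogeneousSl2Triple (h e f : E7) : Prop where
  h_mem : h ∈ E7.gZero
  e_mem : e ∈ E7.gOne
  f_mem : f ∈ E7.gOne
  lie_h_e : ⁅h, e⁆ = (2 : ℂ) • e
  lie_h_f : ⁅h, f⁆ = -((2 : ℂ) • f)
  lie_e_f : ⁅e, f⁆ = h

/-- A homogeneous `𝔰𝔩₂`-triple all of whose members lie in the real form. -/
structure IsRealHomogeneousSl2Triple (h e f : E7) : Prop extends
    IsHomogeneousSl2Triple h e f where
  h_real : h ∈ realForm
  e_real : e ∈ realForm
  f_real : f ∈ realForm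

/-- `Z(h, e, f)`, the group of all `g ∈ SL(8, ℂ)` that fix `h`, `e` and `f`. -/
def tripleStabilizer (h e f : E7) : Subgroup SL8C :=
  MulAction.stabilizer SL8C h ⊓ MulAction.stabilizer SL8C e ⊓ MulAction.stabilizer SL8C f

theorem conjSL_mem_stabilizer {x : E7} (hx : x ∈ realForm) {g : SL8C}
    (hg : g ∈ MulAction.stabilizer SL8C x) : conjSL g ∈ MulAction.stabilizer SL8C x := by
  have h1 : conj x = x := hx
  have h2 : g • x = x := hg
  change conjSL g • x = x
  rw [← h1, ← conj_smul, h2]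

theorem conjSL_mem_tripleStabilizer {h e f : E7} (ht : IsRealHomogeneousSl2Triple h e f)
    {g : SL8C} (hg : g ∈ tripleStabilizer h e f) : conjSL g ∈ tripleStabilizer h e f :=
  ⟨⟨conjSL_mem_stabilizer ht.h_real hg.1.1, conjSL_mem_stabilizer ht.e_real hg.1.2⟩,
    conjSL_mem_stabilizer ht.f_real hg.2⟩

/-- The involution induced by `σ` on `Z(h, e, f)` for a real triple `(h, e, f)`. -/
def conjStabilizer {h e f : E7} (ht : IsRealHomogeneousSl2Triple h e f) :
    MulAut (tripleStabilizer h e f) where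
  toFun g := ⟨conjSL g, conjSL_mem_tripleStabilizer ht g.2⟩
  invFun g := ⟨conjSL g, conjSL_mem_tripleStabilizer ht g.2⟩
  left_inv g := Subtype.ext (conjSL_conjSL g)
  right_inv g := Subtype.ext (conjSL_conjSL g)
  map_mul' g g' := Subtype.ext (map_mul conjSL (g : SL8C) g')

/-- The `SL(8, ℝ)`-orbits of the real points of the orbit `SL(8, ℂ) · e`. -/
def realOrbits (e : E7) : Set (Set E7) :=
  {O | ∃ x ∈ MulAction.orbit SL8C e, x ∈ realForm ∧ O = MulAction.orbit SL8R x}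

end SL8

end

/-! By Hilbert's Theorem 90 (`exists_inv_mul_conjSL_eq`), every cocycle of `SL(8, ℂ)` has the form
`g⁻¹ σ(g)`. If it takes values in a stabilizer, `g` carries the real base point to another real
point. The usual twisting argument then classifies the real orbits in `SL(8, ℂ) · e` by the
cohomology of the full stabilizer of `e`. The real content of the theorem is that this group may be
replaced by the smaller group `Z` fixing the whole triple.

Two facts about triples through a real `e` achieve this. Any triple through `e` can be made real by
an element fixing `e` (`exists_smul_triple_real`), which gives surjectivity. Two real triples
through `e` are conjugate under a real element fixing `e` (`exists_real_smul_triple_eq`), which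
gives injectivity.

Both follow from `exists_smul_h_eq`, a version of Kostant's conjugacy theorem that keeps track of
the grading and of the real structure. If `h` and `h'` are two candidates for the neutral element,
then `d = h' - h` lies in `ker (ad e) ∩ im (ad e)`. One climbs the filtration by the images of `(ad
e) ^ k`. Modulo the next step, `d` equals a vector `y` of weight `k > 0` centralizing `e`
(`exists_weight_vector`), and `exp(-y/k)` fixes `e` and moves `h` to `h + y`. Nilpotency of `ad e`
ends the process. Since `y` is a real polynomial in `ad h` applied to `d`, it stays in `𝔤₀`, and it
is real when `h` and `h'` are. Finally `f` is determined by `h` and `e`, because `ker (ad e)` has no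
negative weights (`eq_zero_of_neg_weight`). -/

noncomputable section

open Matrix

namespace SL8

/-! ### Linear algebra of `𝔰𝔩₂`-triples of endomorphisms -/

section Sl2

variable {M : Type*} [AddCommGroup M] [Module ℂ M] {E H F : Module.End ℂ M}

/-- An eigenvector of `ad H` with nonzero eigenvalue is nilpotent. -/
theorem isNilpotent_of_commutator_eq_smul [FiniteDimensional ℂ M] {c : ℂ} (hc : c ≠ 0)
    (hHE : H * E - E * H = c • E) : IsNilpotent E := by
  by_contra hE
  have hpow : ∀ n : ℕ, H * E ^ n - E ^ n * H = (n * c) • E ^ n := by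
    intro n
    induction n with
    | zero => simp
    | succ n ih =>
      have : H * E ^ (n + 1) - E ^ (n + 1) * H =
          (H * E ^ n - E ^ n * H) * E + E ^ n * (H * E - E * H) := by
        rw [pow_succ]; noncomm_ring
      rw [this, ih, hHE, smul_mul_assoc, mul_smul_comm, ← pow_succ, ← add_smul]
      push_cast
      ring_nf
  -- If no power of `E` vanished, the powers `E ^ n` would be eigenvectors of `ad H` on `End M` for
  -- the infinitely many distinct eigenvalues `n c`, which is impossible in finite dimension.
  let A : Module.End ℂ (Module.End ℂ M) := LinearMap.mulLeft ℂ H - LinearMap.mulRight ℂ H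
  refine Set.infinite_of_injective_forall_mem (f := fun n : ℕ => (n : ℂ) * c) ?_ ?_
    (Module.End.finite_hasEigenvalue A)
  · intro m n hmn
    exact_mod_cast mul_right_cancel₀ hc hmn
  · intro n
    refine Module.End.hasEigenvalue_of_hasEigenvector (x := E ^ n)
      (Module.End.hasEigenvector_iff.mpr ⟨?_, fun h => hE ⟨n, h⟩⟩)
    rw [Module.End.mem_eigenspace_iff]
    simpa [A] using hpow n

/-- The `𝔰𝔩₂` commutation rule `E ^ (n+1) F = F E ^ (n+1) + (n+1) (H - n) E ^ n`, obtained by moving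
one `E` at a time past `F`. It ties the weights on `ker E` to the filtration by the images of the
powers of `E`. -/
theorem pow_succ_lower (hHE : H * E - E * H = (2 : ℂ) • E) (hEF : E * F - F * E = H)
    (n : ℕ) (x : M) :
    (E ^ (n + 1)) (F x) =
      F ((E ^ (n + 1)) x) + (n + 1 : ℂ) • (H ((E ^ n) x) - (n : ℂ) • (E ^ n) x) := by
  induction n with
  | zero =>
    have h1 := LinearMap.congr_fun hEF x
    simp only [LinearMap.sub_apply, Module.End.mul_apply] at h1
    simp [sub_eq_iff_eq_add.mp h1, add_comm]
  | succ n ih =>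
    have h1 := LinearMap.congr_fun hHE ((E ^ n) x)
    have h2 := LinearMap.congr_fun hEF ((E ^ (n + 1)) x)
    simp only [LinearMap.sub_apply, Module.End.mul_apply, LinearMap.smul_apply] at h1 h2
    have h3 : ∀ y, (E ^ (n + 1)) y = E ((E ^ n) y) := fun y => by
      rw [pow_succ', Module.End.mul_apply]
    have h4 : ∀ y, (E ^ (n + 1 + 1)) y = E ((E ^ (n + 1)) y) := fun y => by
      rw [pow_succ', Module.End.mul_apply]
    rw [← h3] at h1
    rw [← h4] at h2
    rw [h4 (F x), ih, map_add, sub_eq_iff_eq_add.mp h2, map_smul, map_sub, map_smul, ← h3,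
      (sub_eq_iff_comm.mp h1).symm]
    push_cast
    module

theorem raise_weight_eq_zero (hHE : H * E - E * H = (2 : ℂ) • E) {v : M} (hv : E v = 0) :
    E (H v) = 0 := by
  have h1 := LinearMap.congr_fun hHE v
  simpa [hv] using h1

/-- On the kernel of `E`, the operator `H - k` maps the image of `E ^ k` to that of `E ^ (k + 1)`. -/
theorem weight_sub_mem_range (hHE : H * E - E * H = (2 : ℂ) • E) (hEF : E * F - F * E = H)
    {k : ℕ} {v : M} (hv : E v = 0) (hk : v ∈ LinearMap.range (E ^ k)) :
    H v - (k : ℂ) • v ∈ LinearMap.range (E ^ (k + 1)) := by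
  obtain ⟨w, rfl⟩ := hk
  have h := pow_succ_lower hHE hEF k w
  rw [pow_succ' E k, Module.End.mul_apply, Module.End.mul_apply, hv, map_zero, zero_add] at h
  have hk0 : (k + 1 : ℂ) ≠ 0 := by exact_mod_cast k.succ_ne_zero
  -- With `v = E ^ k w` and `E v = 0`, the commutation rule reduces to `E ^ (k+1) (F w) = (k+1) (H -
  -- k) v`.
  refine ⟨(k + 1 : ℂ)⁻¹ • F w, ?_⟩
  rw [pow_succ' E k, map_smul, Module.End.mul_apply, h, smul_smul, inv_mul_cancel₀ hk0, one_smul]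

theorem range_pow_mono {m n : ℕ} (h : m ≤ n) :
    LinearMap.range (E ^ n) ≤ LinearMap.range (E ^ m) := by
  rintro _ ⟨w, rfl⟩
  exact ⟨(E ^ (n - m)) w, by rw [← Module.End.mul_apply, ← pow_add, Nat.add_sub_cancel' h]⟩

/-- An element of `ker E ∩ im E ^ k` has the same class modulo `im E ^ (k + 1)` as a vector of
weight `k` in `ker E`, which is obtained from it by a real polynomial in `H`. -/
theorem exists_weight_vector (hHE : H * E - E * H = (2 : ℂ) • E) (hEF : E * F - F * E = H)
    (hE : IsNilpotent E) {k : ℕ} {d : M} (hd : E d = 0) (hk : d ∈ LinearMap.range (E ^ k)) :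
    ∃ y, E y = 0 ∧ H y = (k : ℂ) • y ∧ d - y ∈ LinearMap.range (E ^ (k + 1)) ∧
      ∀ S : AddSubgroup M, (∀ x ∈ S, H x ∈ S) → (∀ (r : ℝ), ∀ x ∈ S, (r : ℂ) • x ∈ S) →
        d ∈ S → y ∈ S := by
  -- Successive approximation: `(H - k) y` is pushed one step deeper into the filtration at each
  -- stage, while the class of `y` modulo `im E ^ (k+1)` is kept.
  have key : ∀ m : ℕ, ∃ y, E y = 0 ∧
      H y - (k : ℂ) • y ∈ LinearMap.range (E ^ (k + m + 1)) ∧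
      d - y ∈ LinearMap.range (E ^ (k + 1)) ∧
      ∀ S : AddSubgroup M, (∀ x ∈ S, H x ∈ S) → (∀ (r : ℝ), ∀ x ∈ S, (r : ℂ) • x ∈ S) →
        d ∈ S → y ∈ S := by
    intro m
    induction m with
    | zero =>
      exact ⟨d, hd, weight_sub_mem_range hHE hEF hd hk, by simp, fun S _ _ h => h⟩
    | succ m ih =>
      obtain ⟨y, hy, hy1, hy2, hy3⟩ := ih
      have hm : (-(m + 1) : ℂ) ≠ 0 := neg_ne_zero.mpr (by exact_mod_cast m.succ_ne_zero)
      set z := H y - (k : ℂ) • y with hz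
      have hEz : E z = 0 := by rw [hz, map_sub, map_smul, hy, raise_weight_eq_zero hHE hy]; simp
      have hz1 := weight_sub_mem_range hHE hEF hEz hy1
      have hy' : H y = z + (k : ℂ) • y := by rw [hz]; abel
      -- The factor `H - (k+m+1)` sends `z = (H - k) y` one level deeper. The scalar normalizes the
      -- new vector to `y - z/(m+1)`, which differs from `y` only by an element of `im E ^ (k+m+1)`.
      -- It is real so that real structures are preserved.
      refine ⟨((-(m + 1 : ℝ))⁻¹ : ℝ) • (H y - ((k + m + 1 : ℝ) : ℂ) • y), ?_, ?_, ?_, ?_⟩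
      · rw [← Complex.coe_smul, map_smul, map_sub, map_smul, hy, raise_weight_eq_zero hHE hy]; simp
      · have : H (((-(m + 1 : ℝ))⁻¹ : ℝ) • (H y - ((k + m + 1 : ℝ) : ℂ) • y)) -
            (k : ℂ) • (((-(m + 1 : ℝ))⁻¹ : ℝ) • (H y - ((k + m + 1 : ℝ) : ℂ) • y)) =
            (-(m + 1) : ℂ)⁻¹ • (H z - ((k + m + 1 : ℕ) : ℂ) • z) := by
          rw [← Complex.coe_smul, map_smul, map_sub, map_smul, hz, map_sub, map_smul]
          push_cast
          module
        rw [this]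
        exact Submodule.smul_mem _ _ hz1
      · have : d - ((-(m + 1 : ℝ))⁻¹ : ℝ) • (H y - ((k + m + 1 : ℝ) : ℂ) • y) =
            (d - y) - (-(m + 1) : ℂ)⁻¹ • z := by
          have h5 : y = (-(m + 1) : ℂ)⁻¹ • (-(m + 1) : ℂ) • y := by
            rw [smul_smul, inv_mul_cancel₀ hm, one_smul]
          conv_rhs => rw [h5]
          rw [← Complex.coe_smul, hy']
          push_cast
          module
        rw [this]
        exact Submodule.sub_mem _ hy2 (Submodule.smul_mem _ _ (range_pow_mono (by omega) hy1))
      · intro S hS hr hdS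
        rw [← Complex.coe_smul]
        exact hr _ _ (S.sub_mem (hS _ (hy3 S hS hr hdS)) (hr _ _ (hy3 S hS hr hdS)))
  obtain ⟨n, hn⟩ := hE
  obtain ⟨y, h1, h2, h3, h4⟩ := key n
  refine ⟨y, h1, ?_, h3, h4⟩
  -- At stage `n`, where `E ^ n = 0`, the error term lies in a zero image, so `y` is an exact weight
  -- vector.
  have h5 : E ^ (k + n + 1) = 0 := by rw [show k + n + 1 = n + (k + 1) by ring, pow_add, hn, zero_mul]
  rw [h5] at h2
  simpa [sub_eq_zero] using h2

/-- The kernel of `E` contains no vector of negative weight. -/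
theorem eq_zero_of_neg_weight (hHE : H * E - E * H = (2 : ℂ) • E) (hEF : E * F - F * E = H)
    (hE : IsNilpotent E) {x : M} (hx : E x = 0) (hH : H x = -((2 : ℂ) • x)) : x = 0 := by
  -- On `x` the operator `H - n` is the scalar `-(2+n)`, which is never zero, so `x` climbs through
  -- the whole filtration, and that ends at zero.
  have key : ∀ n : ℕ, x ∈ LinearMap.range (E ^ n) := by
    intro n
    induction n with
    | zero => simp
    | succ n ih =>
      have h := weight_sub_mem_range hHE hEF hx ih
      have h0 : (-(2 + n) : ℂ) ≠ 0 := neg_ne_zero.mpr (by exact_mod_cast (by omega : 2 + n ≠ 0))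
      have h1 : H x - (n : ℂ) • x = (-(2 + n) : ℂ) • x := by rw [hH]; module
      rw [h1] at h
      exact (Submodule.smul_mem_iff _ h0).mp h
  obtain ⟨n, hn⟩ := hE
  simpa [hn] using key n

end Sl2

/-! ### Exponentials of nilpotent matrices -/

/-- The matrices `y` with `[h, y] = c y` and `c ≠ 0` are nilpotent. -/
theorem isNilpotent_of_lie_eq_smul {h y : Matrix (Fin 8) (Fin 8) ℂ} {c : ℂ} (hc : c ≠ 0)
    (hy : h * y - y * h = c • y) : IsNilpotent y := by
  have h1 : IsNilpotent (Matrix.toLinAlgEquiv' y) := by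
    refine isNilpotent_of_commutator_eq_smul (H := Matrix.toLinAlgEquiv' h) hc ?_
    rw [← map_mul, ← map_mul, ← map_sub, hy, map_smul]
  exact (IsNilpotent.map_iff Matrix.toLinAlgEquiv'.injective).mp h1

/-- The characteristic polynomial of `-N` differs from a power of `X` by a nilpotent polynomial,
hence equals it. Its value at `1` is the determinant in question. -/
theorem det_one_add_of_isNilpotent {n : Type} [Fintype n] [DecidableEq n] {N : Matrix n n ℂ}
    (hN : IsNilpotent N) : (1 + N).det = 1 := by
  have h1 := Matrix.isNilpotent_charpoly_sub_pow_of_isNilpotent hN.neg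
  have h2 := sub_eq_zero.mp h1.eq_zero
  have h3 := Matrix.eval_charpoly (-N) 1
  rw [h2] at h3
  simpa using h3.symm

theorem det_exp_of_isNilpotent {y : Matrix (Fin 8) (Fin 8) ℂ} (hy : IsNilpotent y) :
    (IsNilpotent.exp y).det = 1 := by
  have := det_one_add_of_isNilpotent (IsNilpotent.isNilpotent_exp_sub_one hy)
  rwa [add_sub_cancel] at this

/-- The exponential of a nilpotent matrix, as an element of `SL(8, ℂ)`. -/
def expSL (y : Matrix (Fin 8) (Fin 8) ℂ) (hy : IsNilpotent y) : SL8C :=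
  ⟨IsNilpotent.exp y, det_exp_of_isNilpotent hy⟩

theorem conjSL_expSL {y : Matrix (Fin 8) (Fin 8) ℂ} (hy : IsNilpotent y)
    (hc : y.map (starRingEnd ℂ) = y) : conjSL (expSL y hy) = expSL y hy := by
  apply Subtype.ext
  change (starRingEnd ℂ).mapMatrix (IsNilpotent.exp y) = IsNilpotent.exp y
  rw [IsNilpotent.map_exp hy]
  congr 1

/-- Bracketing with `h` is a derivation and `y` is an eigenvector, so `[h, y ^ n] = n c y ^ n`. In
the exponential series the factor `n` cancels against `n!` and shifts the index by one. -/
theorem lie_exp {h y : Matrix (Fin 8) (Fin 8) ℂ} {c : ℂ} (hn : IsNilpotent y)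
    (hy : h * y - y * h = c • y) :
    h * IsNilpotent.exp y - IsNilpotent.exp y * h = c • (y * IsNilpotent.exp y) := by
  have hpow : ∀ n : ℕ, h * y ^ n - y ^ n * h = (n * c) • y ^ n := by
    intro n
    induction n with
    | zero => simp
    | succ n ih =>
      have : h * y ^ (n + 1) - y ^ (n + 1) * h =
          (h * y ^ n - y ^ n * h) * y + y ^ n * (h * y - y * h) := by
        rw [pow_succ]; noncomm_ring
      rw [this, ih, hy, smul_mul_assoc, mul_smul_comm, ← pow_succ, ← add_smul]
      push_cast
      ring_nf
  obtain ⟨N, hN⟩ := hn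
  -- The left side is expanded with one more term than the right, so that the two sums match after
  -- the index shift.
  have hN' : y ^ (N + 1) = 0 := by rw [pow_succ, hN, zero_mul]
  conv_lhs => rw [IsNilpotent.exp_eq_sum hN']
  rw [IsNilpotent.exp_eq_sum hN, Finset.mul_sum, Finset.sum_mul, ← Finset.sum_sub_distrib,
    Finset.sum_range_succ', Finset.mul_sum, Finset.smul_sum]
  simp only [mul_smul_comm, smul_mul_assoc, ← smul_sub, hpow]
  rw [Nat.cast_zero, zero_mul, zero_smul, smul_zero, add_zero]
  refine Finset.sum_congr rfl fun i _ => ?_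
  rw [← pow_succ', ← Rat.cast_smul_eq_qsmul ℂ, ← Rat.cast_smul_eq_qsmul ℂ, smul_smul, smul_smul]
  congr 1
  have hi : (i + 1 : ℂ) ≠ 0 := by exact_mod_cast i.succ_ne_zero
  have hf : (i.factorial : ℂ) ≠ 0 := by exact_mod_cast i.factorial_ne_zero
  rw [Nat.factorial_succ]
  push_cast
  field_simp

/-- Only the linear term of `exp (ad y) h` survives, since `[y, h] = -c y` commutes with `y`. -/
theorem expSL_conj {h y : Matrix (Fin 8) (Fin 8) ℂ} {c : ℂ} (hn : IsNilpotent y)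
    (hy : h * y - y * h = c • y) :
    (expSL y hn : Matrix (Fin 8) (Fin 8) ℂ) * h *
      (((expSL y hn)⁻¹ : SL8C) : Matrix (Fin 8) (Fin 8) ℂ) = h - c • y := by
  have h1 : (expSL y hn : Matrix (Fin 8) (Fin 8) ℂ) * h =
      (h - c • y) * (expSL y hn : Matrix (Fin 8) (Fin 8) ℂ) := by
    change IsNilpotent.exp y * h = (h - c • y) * IsNilpotent.exp y
    rw [sub_mul, smul_mul_assoc, ← lie_exp hn hy]
    abel
  rw [h1, Matrix.mul_assoc, ← Matrix.SpecialLinearGroup.coe_mul, mul_inv_cancel,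
    Matrix.SpecialLinearGroup.coe_one, Matrix.mul_one]

/-! ### The exponential of the action on four-vectors -/

section Slot

variable {N : Type} [AddCommGroup N] [Module ℂ N]

/-- Precomposition of a quadrilinear map with `A` in the `k`-th variable. -/
def slot (k : Fin 4) (A : Module.End ℂ V) :
    Module.End ℂ (MultilinearMap ℂ (fun _ : Fin 4 => V) N) where
  toFun f := f.compLinearMap (fun i => if i = k then A else LinearMap.id)
  map_add' f g := by ext1 v; rfl
  map_smul' c f := by ext1 v; rfl

theorem slot_apply (k : Fin 4) (A : Module.End ℂ V) (f : MultilinearMap ℂ (fun _ : Fin 4 => V) N)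
    (v : Fin 4 → V) : slot k A f v = f (Function.update v k (A (v k))) := by
  change f _ = f _
  congr 1
  ext l : 1
  by_cases hl : l = k
  · subst hl; simp
  · simp [hl]

/-- Operators on different arguments commute, which allows the exponential of the derivation action
to be split into a product over the four slots. -/
theorem slot_commute {k l : Fin 4} (hkl : k ≠ l) (A B : Module.End ℂ V) :
    Commute (slot (N := N) k A) (slot l B) := by
  refine LinearMap.ext fun f => MultilinearMap.ext fun v => ?_
  simp only [Module.End.mul_apply, slot_apply]
  rw [Function.update_of_ne hkl, Function.update_of_ne hkl.symm, Function.update_comm hkl]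

/-- `slot k`, as a ring homomorphism. -/
def slotHom (k : Fin 4) :
    -- Precomposition reverses products, hence the opposite ring.
    (Module.End ℂ V)ᵐᵒᵖ →+* Module.End ℂ (MultilinearMap ℂ (fun _ : Fin 4 => V) N) where
  toFun A := slot k A.unop
  map_one' := by
    refine LinearMap.ext fun f => MultilinearMap.ext fun v => ?_
    simp [slot_apply]
  map_mul' A B := by
    refine LinearMap.ext fun f => MultilinearMap.ext fun v => ?_
    simp [slot_apply]
  map_zero' := by
    refine LinearMap.ext fun f => MultilinearMap.ext fun v => ?_
    simp [slot_apply]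
  map_add' A B := by
    refine LinearMap.ext fun f => MultilinearMap.ext fun v => ?_
    simp [slot_apply]

theorem isNilpotent_op {A : Module.End ℂ V} (hA : IsNilpotent A) :
    IsNilpotent (MulOpposite.op A) := by
  obtain ⟨n, hn⟩ := hA
  exact ⟨n, by rw [← MulOpposite.op_pow, hn, MulOpposite.op_zero]⟩

theorem isNilpotent_slot (k : Fin 4) {A : Module.End ℂ V} (hA : IsNilpotent A) :
    IsNilpotent (slot (N := N) k A) :=
  (isNilpotent_op hA).map (slotHom k)

theorem exp_slot [Module ℚ N] (k : Fin 4) {A : Module.End ℂ V} (hA : IsNilpotent A) :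
    IsNilpotent.exp (slot (N := N) k A) = slot k (IsNilpotent.exp A) := by
  have h2 : IsNilpotent.exp (MulOpposite.op A) = MulOpposite.op (IsNilpotent.exp A) := by
    obtain ⟨n, hn⟩ := hA
    rw [IsNilpotent.exp_eq_sum hn, IsNilpotent.exp_eq_sum (k := n)
      (by rw [← MulOpposite.op_pow, hn, MulOpposite.op_zero])]
    exact (map_sum MulOpposite.opAddEquiv _ _).symm
  have h3 := IsNilpotent.map_exp (isNilpotent_op hA) (slotHom (N := N) k)
  rw [h2] at h3
  exact h3.symm

/-- If the derivation action of `A` on a quadrilinear map `f` is given by an endomorphism `φ`, then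
the diagonal action of `exp A` is given by the exponential series of `φ`. -/
theorem exists_exp_comp_eq_sum [Module ℚ N] {A : Module.End ℂ V} (hA : IsNilpotent A)
    (f : MultilinearMap ℂ (fun _ : Fin 4 => V) N) (φ : Module.End ℂ N)
    (hf : ∀ v, ∑ k, f (Function.update v k (A (v k))) = φ (f v)) :
    ∃ n : ℕ, ∀ v : Fin 4 → V, f (fun i => IsNilpotent.exp A (v i)) =
      ∑ i ∈ Finset.range (n + 1), ((i.factorial : ℂ)⁻¹) • (φ ^ i) (f v) := by
  let T : Fin 4 → Module.End ℂ (MultilinearMap ℂ (fun _ : Fin 4 => V) N) := fun k => slot k A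
  have hT : ∀ k, IsNilpotent (T k) := fun k => isNilpotent_slot k hA
  have hc : ∀ {k l}, k ≠ l → Commute (T k) (T l) := fun h => slot_commute h A A
  have c01 : Commute (T 0) (T 1) := hc (by decide)
  have c02 : Commute (T 0 + T 1) (T 2) := (hc (by decide)).add_left (hc (by decide))
  have c03 : Commute (T 0 + T 1 + T 2) (T 3) :=
    ((hc (by decide)).add_left (hc (by decide))).add_left (hc (by decide))
  have n01 := c01.isNilpotent_add (hT 0) (hT 1)
  have n02 := c02.isNilpotent_add n01 (hT 2)
  have n03 := c03.isNilpotent_add n02 (hT 3)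
  -- The sum of the slot operators is the derivation action of `A`. Its exponential factors into the
  -- slotwise exponentials, that is, into the diagonal action of `exp A`.
  have hexp : IsNilpotent.exp (T 0 + T 1 + T 2 + T 3) =
      slot 0 (IsNilpotent.exp A) * slot 1 (IsNilpotent.exp A) *
      slot 2 (IsNilpotent.exp A) * slot 3 (IsNilpotent.exp A) := by
    rw [IsNilpotent.exp_add_of_commute c03 n02 (hT 3),
      IsNilpotent.exp_add_of_commute c02 n01 (hT 2),
      IsNilpotent.exp_add_of_commute c01 (hT 0) (hT 1), exp_slot 0 hA, exp_slot 1 hA,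
      exp_slot 2 hA, exp_slot 3 hA]
  set D := T 0 + T 1 + T 2 + T 3 with hDdef
  -- Allowing an arbitrary `ψ` after `f` makes the rule iterable: the powers of `D` on `f` become
  -- the powers of `φ` after `f`.
  have hD : ∀ ψ : Module.End ℂ N, D (ψ.compMultilinearMap f) = (ψ * φ).compMultilinearMap f := by
    intro ψ
    refine MultilinearMap.ext fun v => ?_
    have h1 : (ψ * φ).compMultilinearMap f v = ψ (φ (f v)) := rfl
    rw [h1, ← hf, Fin.sum_univ_four]
    simp only [hDdef, T, LinearMap.add_apply, _root_.add_apply, slot_apply, map_add]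
    rfl
  have hDpow : ∀ n, (D ^ n) f = (φ ^ n).compMultilinearMap f := by
    intro n
    induction n with
    | zero => rfl
    | succ n ih => rw [pow_succ', Module.End.mul_apply, ih, hD, ← pow_succ]
  obtain ⟨n, hn⟩ := n03
  -- The sum has `n + 1` terms although `D ^ n = 0`, so it always contains the term of degree zero.
  refine ⟨n, fun v => ?_⟩
  have h1 : IsNilpotent.exp D f v = f (fun i => IsNilpotent.exp A (v i)) := by
    rw [hexp]
    simp only [Module.End.mul_apply, slot_apply]
    congr 1
    ext k : 1
    fin_cases k <;> rfl
  rw [← h1, IsNilpotent.exp_eq_sum (k := n + 1) (by rw [pow_succ, hn, zero_mul]),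
    LinearMap.sum_apply, _root_.sum_apply]
  refine Finset.sum_congr rfl fun i _ => ?_
  rw [← Rat.cast_smul_eq_qsmul ℂ, LinearMap.smul_apply, hDpow]
  push_cast
  rfl

end Slot

/-- A nilpotent matrix annihilating a four-vector has an exponential fixing it. -/
theorem map_exp_of_act_eq_zero {y : Matrix (Fin 8) (Fin 8) ℂ} (hy : IsNilpotent y) {x : Wedge4}
    (hx : act y x = 0) : exteriorPower.map 4 (Matrix.toLin' (IsNilpotent.exp y)) x = x := by
  have hA : IsNilpotent (Matrix.toLinAlgEquiv' y) := hy.map Matrix.toLinAlgEquiv'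
  have hexpA : Matrix.toLin' (IsNilpotent.exp y) = IsNilpotent.exp (Matrix.toLinAlgEquiv' y) :=
    IsNilpotent.map_exp hy Matrix.toLinAlgEquiv'
  -- Rational scalars on the target are needed to form exponentials of operators on quadrilinear
  -- maps.
  let _ : Module ℚ Wedge4 := Module.compHom _ (algebraMap ℚ ℂ)
  obtain ⟨n, hn⟩ := exists_exp_comp_eq_sum hA
    (exteriorPower.ιMulti ℂ 4 (M := V)).toMultilinearMap (act y) fun v => (act_ιMulti y v).symm
  have key : exteriorPower.map 4 (IsNilpotent.exp (Matrix.toLinAlgEquiv' y)) =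
      ∑ i ∈ Finset.range (n + 1), ((i.factorial : ℂ)⁻¹) • (act y ^ i) := by
    refine linearMap_wedge4_ext fun v => ?_
    rw [exteriorPower.map_apply_ιMulti, LinearMap.sum_apply]
    exact hn v
  rw [hexpA, key, Finset.sum_range_succ', LinearMap.add_apply, LinearMap.sum_apply,
    Finset.sum_eq_zero]
  · simp
  · intro i _
    rw [LinearMap.smul_apply, pow_succ, Module.End.mul_apply, hx, map_zero, smul_zero]

/-! ### Complex conjugation and the group action are compatible with the bracket -/

theorem detRowAlternating_eq_det {n : Type} [Fintype n] [DecidableEq n] (v : n → n → ℂ) :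
    Matrix.detRowAlternating v = Matrix.det (Matrix.of v) := rfl

theorem det8_eq_det (v : Fin 8 → V) : det8 v = Matrix.det (Matrix.of v) := by
  rw [det8]; exact detRowAlternating_eq_det v

theorem wedgePairing_wedgeConj (u v : Wedge4) :
    wedgePairing (wedgeConj u) (wedgeConj v) = starRingEnd ℂ (wedgePairing u v) := by
  have h0 : wedgeConj (0 : Wedge4) = 0 := by simpa using wedgeConj_smul 0 (0 : Wedge4)
  induction u using wedge4_induction with
  | h0 => simp [h0]
  | hadd x y hx hy => simp [wedgeConj_add, hx, hy]
  | hsmul c x hx => simp [wedgeConj_smul, hx]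
  | h a =>
    induction v using wedge4_induction with
    | h0 => simp [h0]
    | hadd x y hx hy => simp [wedgeConj_add, hx, hy]
    | hsmul c x hx => simp [wedgeConj_smul, hx]
    | h b =>
      rw [wedgeConj_ιMulti, wedgeConj_ιMulti, wedgePairing_ιMulti, wedgePairing_ιMulti]
      rw [det8_eq_det, det8_eq_det, RingHom.map_det]
      congr 1
      ext i j
      fin_cases i <;> rfl

theorem act_wedgeConj (A : Matrix (Fin 8) (Fin 8) ℂ) (u : Wedge4) :
    act (A.map (starRingEnd ℂ)) (wedgeConj u) = wedgeConj (act A u) := by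
  have h0 : wedgeConj (0 : Wedge4) = 0 := by simpa using wedgeConj_smul 0 (0 : Wedge4)
  induction u using wedge4_induction with
  | h0 => simp [h0]
  | hadd x y hx hy => simp [wedgeConj_add, hx, hy]
  | hsmul c x hx => simp [wedgeConj_smul, hx]
  | h a =>
    rw [wedgeConj_ιMulti, act_ιMulti, act_ιMulti]
    simp only [Fin.sum_univ_four, wedgeConj_add, wedgeConj_ιMulti]
    have : ∀ k : Fin 4, (Function.update (fun i j => starRingEnd ℂ (a i j)) k
        (A.map (starRingEnd ℂ) *ᵥ fun j => starRingEnd ℂ (a k j)) : Fin 4 → V) =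
        fun i j => starRingEnd ℂ (Function.update a k (A *ᵥ a k) i j) := by
      intro k
      ext i j
      by_cases hi : i = k
      · subst hi
        simp [Matrix.mulVec, dotProduct]
      · simp [hi]
    simp only [this]

/-- The entries of the bracket are real expressions in the pairing and in the action of the real
matrices `Matrix.single j i 1`, both of which commute with conjugation. -/
theorem bracketWedge_wedgeConj (u v : Wedge4) :
    bracketWedge (wedgeConj u) (wedgeConj v) = (bracketWedge u v).map (starRingEnd ℂ) := by
  ext i j
  have h1 : (Matrix.single j i (1 : ℂ)).map (starRingEnd ℂ) = Matrix.single j i 1 := by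
    ext a b
    by_cases h : j = a ∧ i = b <;> simp [h]
  have h2 : wedgePairing (act (Matrix.single j i 1) (wedgeConj u)) (wedgeConj v) =
      starRingEnd ℂ (wedgePairing (act (Matrix.single j i 1) u) v) := by
    rw [← wedgePairing_wedgeConj, ← act_wedgeConj, h1]
  rw [Matrix.map_apply, bracketWedge_apply, bracketWedge_apply, Matrix.sub_apply, Matrix.sub_apply,
    Matrix.of_apply, Matrix.of_apply, h2, map_sub, wedgePairing_wedgeConj]
  by_cases h : i = j <;> simp [h, map_ofNat]

theorem wedgeConj_neg (x : Wedge4) : wedgeConj (-x) = -wedgeConj x := by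
  have h0 : wedgeConj (0 : Wedge4) = 0 := by simpa using wedgeConj_smul 0 (0 : Wedge4)
  refine eq_neg_of_add_eq_zero_left ?_
  rw [← wedgeConj_add, neg_add_cancel, h0]

theorem wedgeConj_sub (x y : Wedge4) : wedgeConj (x - y) = wedgeConj x - wedgeConj y := by
  rw [sub_eq_add_neg, wedgeConj_add, wedgeConj_neg, sub_eq_add_neg]

theorem conj_fst (x : E7) :
    ((conj x).1 : Matrix (Fin 8) (Fin 8) ℂ) = (x.1 : Matrix (Fin 8) (Fin 8) ℂ).map (starRingEnd ℂ) :=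
  rfl

theorem conj_snd (x : E7) : (conj x).2 = wedgeConj x.2 := rfl

theorem conj_add (x y : E7) : conj (x + y) = conj x + conj y := by
  refine E7.ext' ?_ (wedgeConj_add x.2 y.2)
  ext i j
  simp [conj_fst, E7.add_fst]

theorem conj_smul_complex (c : ℂ) (x : E7) : conj (c • x) = starRingEnd ℂ c • conj x := by
  refine E7.ext' ?_ (wedgeConj_smul c x.2)
  ext i j
  simp [conj_fst, E7.smul_fst]

theorem conj_neg (x : E7) : conj (-x) = -conj x := by
  simpa using conj_smul_complex (-1) x

theorem conj_conj (x : E7) : conj (conj x) = x := by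
  refine E7.ext' ?_ ?_
  · ext i j
    simp [conj_fst]
  · rw [conj_snd, conj_snd]
    induction x.2 using wedge4_induction with
    | h0 =>
      have h0 : wedgeConj (0 : Wedge4) = 0 := by simpa using wedgeConj_smul 0 (0 : Wedge4)
      rw [h0, h0]
    | hadd x y hx hy => rw [wedgeConj_add, wedgeConj_add, hx, hy]
    | hsmul c x hx => rw [wedgeConj_smul, wedgeConj_smul, hx, Complex.conj_conj]
    | h a => simp [wedgeConj_ιMulti]

/-- With antilinearity, this makes `σ` carry triples to triples and makes `ad h` preserve the real
form when `h` is real. -/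
theorem conj_lie (x y : E7) : conj ⁅x, y⁆ = ⁅conj x, conj y⁆ := by
  refine E7.ext' ?_ ?_
  · rw [E7.lie_fst, conj_fst, E7.lie_fst, conj_fst, conj_fst, conj_snd, conj_snd,
      bracketWedge_wedgeConj, ← Matrix.map_mul, ← Matrix.map_mul]
    ext i j
    simp only [Matrix.map_apply, Matrix.add_apply, Matrix.sub_apply, map_add, map_sub]
  · rw [E7.lie_snd, conj_snd, E7.lie_snd, conj_fst, conj_fst, conj_snd, conj_snd, act_wedgeConj,
      act_wedgeConj]
    exact wedgeConj_sub _ _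

/-! ### Equivariance of the pairing and the brackets under `SL(8, ℂ)` -/

theorem det8_app_mulVec (A : Matrix (Fin 8) (Fin 8) ℂ) (a b : Fin 4 → V) :
    det8 (app (fun i => A *ᵥ a i) fun i => A *ᵥ b i) = A.det * det8 (app a b) := by
  have h : Matrix.of (app (fun i => A *ᵥ a i) fun i => A *ᵥ b i) = Matrix.of (app a b) * Aᵀ := by
    ext i j
    have h1 : app (fun i => A *ᵥ a i) (fun i => A *ᵥ b i) i = A *ᵥ app a b i := by
      refine Fin.addCases (m := 4) (n := 4) (fun k => ?_) (fun k => ?_) i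
      · rw [app_castAdd, app_castAdd]
      · rw [app_natAdd, app_natAdd]
    rw [Matrix.of_apply, h1]
    exact dotProduct_comm _ _
  rw [det8_eq_det, det8_eq_det, h, Matrix.det_mul, Matrix.det_transpose, mul_comm]

theorem wedgePairing_map (A : Matrix (Fin 8) (Fin 8) ℂ) (u v : Wedge4) :
    wedgePairing (exteriorPower.map 4 (Matrix.toLin' A) u) (exteriorPower.map 4 (Matrix.toLin' A) v) =
      A.det * wedgePairing u v := by
  induction u using wedge4_induction with
  | h0 => simp
  | hadd x y hx hy => simp only [map_add, LinearMap.add_apply, hx, hy, mul_add]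
  | hsmul c x hx => simp only [map_smul, LinearMap.smul_apply, hx, smul_eq_mul, mul_left_comm]
  | h a =>
    induction v using wedge4_induction with
    | h0 => simp
    | hadd x y hx hy => simp only [map_add, hx, hy, mul_add]
    | hsmul c x hx => simp only [map_smul, hx, smul_eq_mul, mul_left_comm]
    | h b =>
      have h1 : ∀ v : Fin 4 → V, Matrix.toLin' A ∘ v = fun i => A *ᵥ v i := fun v => by
        ext i : 1
        rw [Function.comp_apply, Matrix.toLin'_apply]
      rw [exteriorPower.map_apply_ιMulti, exteriorPower.map_apply_ιMulti, wedgePairing_ιMulti,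
        wedgePairing_ιMulti, h1, h1]
      exact det8_app_mulVec A a b

theorem act_conj (g : SL8C) (B : Matrix (Fin 8) (Fin 8) ℂ) (u : Wedge4) :
    act (g * B * ((g⁻¹ : SL8C) : Matrix (Fin 8) (Fin 8) ℂ))
      (exteriorPower.map 4 (Matrix.toLin' (g : Matrix (Fin 8) (Fin 8) ℂ)) u) =
      exteriorPower.map 4 (Matrix.toLin' (g : Matrix (Fin 8) (Fin 8) ℂ)) (act B u) := by
  induction u using wedge4_induction with
  | h0 => simp
  | hadd x y hx hy => simp only [map_add, hx, hy]
  | hsmul c x hx => simp only [map_smul, hx]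
  | h a =>
    rw [exteriorPower.map_apply_ιMulti, act_ιMulti, act_ιMulti, map_sum]
    refine Finset.sum_congr rfl fun k _ => ?_
    rw [exteriorPower.map_apply_ιMulti]
    congr 1
    ext i : 1
    by_cases hi : i = k
    · subst hi
      simp only [Function.update_self, Function.comp_apply, Matrix.toLin'_apply,
        Matrix.mulVec_mulVec]
      rw [Matrix.mul_assoc, ← Matrix.SpecialLinearGroup.coe_mul, inv_mul_cancel,
        Matrix.SpecialLinearGroup.coe_one, Matrix.mul_one]
    · simp [hi]

/-- The trace form is nondegenerate, so it suffices to test against every `A`. Pulling `A` back to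
`g⁻¹ A g` moves `g` out of both arguments of the pairing, which is invariant because `det g = 1`. -/
theorem bracketWedge_map (g : SL8C) (u v : Wedge4) :
    bracketWedge (exteriorPower.map 4 (Matrix.toLin' (g : Matrix (Fin 8) (Fin 8) ℂ)) u)
      (exteriorPower.map 4 (Matrix.toLin' (g : Matrix (Fin 8) (Fin 8) ℂ)) v) =
      g * bracketWedge u v * ((g⁻¹ : SL8C) : Matrix (Fin 8) (Fin 8) ℂ) := by
  refine matrix_ext_trace fun A => ?_
  have hgg : (g : Matrix (Fin 8) (Fin 8) ℂ) * ((g⁻¹ : SL8C) : Matrix (Fin 8) (Fin 8) ℂ) = 1 := by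
    rw [← Matrix.SpecialLinearGroup.coe_mul, mul_inv_cancel, Matrix.SpecialLinearGroup.coe_one]
  set B := ((g⁻¹ : SL8C) : Matrix (Fin 8) (Fin 8) ℂ) * A * g with hB
  have hA : A = g * B * ((g⁻¹ : SL8C) : Matrix (Fin 8) (Fin 8) ℂ) := by
    rw [hB, ← Matrix.mul_assoc, ← Matrix.mul_assoc, hgg, Matrix.one_mul, Matrix.mul_assoc, hgg,
      Matrix.mul_one]
  have h1 : (A * (g * bracketWedge u v * ((g⁻¹ : SL8C) : Matrix (Fin 8) (Fin 8) ℂ))).trace =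
      (B * bracketWedge u v).trace := by
    rw [← Matrix.mul_assoc, Matrix.trace_mul_comm, hB]
    simp only [Matrix.mul_assoc]
  have h2 : A.trace = B.trace := by
    rw [hB, Matrix.trace_mul_comm, ← Matrix.mul_assoc, hgg, Matrix.one_mul]
  rw [h1, trace_mul_bracketWedge, trace_mul_bracketWedge, h2]
  conv_lhs => rw [hA, act_conj]
  rw [wedgePairing_map, wedgePairing_map, g.2, one_mul, one_mul]

theorem smul_lie (g : SL8C) (x y : E7) : g • ⁅x, y⁆ = ⁅g • x, g • y⁆ := by
  refine E7.ext' ?_ ?_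
  · have hgg : ((g⁻¹ : SL8C) : Matrix (Fin 8) (Fin 8) ℂ) * (g : Matrix (Fin 8) (Fin 8) ℂ) = 1 := by
      rw [← Matrix.SpecialLinearGroup.coe_mul, inv_mul_cancel, Matrix.SpecialLinearGroup.coe_one]
    have h1 : ∀ X Y : Matrix (Fin 8) (Fin 8) ℂ,
        (g : Matrix (Fin 8) (Fin 8) ℂ) * X * ((g⁻¹ : SL8C) : Matrix (Fin 8) (Fin 8) ℂ) *
          (g * Y * ((g⁻¹ : SL8C) : Matrix (Fin 8) (Fin 8) ℂ)) =
        g * (X * Y) * ((g⁻¹ : SL8C) : Matrix (Fin 8) (Fin 8) ℂ) := by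
      intro X Y
      calc _ = (g : Matrix (Fin 8) (Fin 8) ℂ) * X * (((g⁻¹ : SL8C) : Matrix (Fin 8) (Fin 8) ℂ) * g) *
            Y * ((g⁻¹ : SL8C) : Matrix (Fin 8) (Fin 8) ℂ) := by simp only [Matrix.mul_assoc]
        _ = _ := by rw [hgg]; simp only [Matrix.mul_assoc, Matrix.one_mul]
    rw [smul_fst, E7.lie_fst, E7.lie_fst, smul_fst, smul_fst, smul_snd, smul_snd,
      bracketWedge_map, h1, h1, Matrix.mul_add, Matrix.add_mul, Matrix.mul_sub, Matrix.sub_mul]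
  · rw [smul_snd, E7.lie_snd, E7.lie_snd, smul_fst, smul_fst, smul_snd, smul_snd, act_conj,
      act_conj, map_sub]

theorem smul_smul_complex (g : SL8C) (c : ℂ) (x : E7) : g • (c • x) = c • (g • x) := by
  refine E7.ext' ?_ ?_
  · simp only [smul_fst, E7.smul_fst, Matrix.mul_smul, Matrix.smul_mul]
  · simp only [smul_snd, E7.smul_snd, map_smul]

theorem smul_mem_gZero (g : SL8C) {x : E7} (hx : x ∈ E7.gZero) : g • x ∈ E7.gZero := by
  have h : x.2 = 0 := hx
  change (g • x).2 = 0
  rw [smul_snd, h, map_zero]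

theorem smul_mem_gOne (g : SL8C) {x : E7} (hx : x ∈ E7.gOne) : g • x ∈ E7.gOne := by
  have h : x.1 = 0 := hx
  change (g • x).1 = 0
  apply Subtype.ext
  rw [smul_fst, h]
  simp

theorem IsHomogeneousSl2Triple.smul {h e f : E7} (ht : IsHomogeneousSl2Triple h e f) (g : SL8C) :
    IsHomogeneousSl2Triple (g • h) (g • e) (g • f) where
  h_mem := smul_mem_gZero g ht.h_mem
  e_mem := smul_mem_gOne g ht.e_mem
  f_mem := smul_mem_gOne g ht.f_mem
  lie_h_e := by rw [← smul_lie, ht.lie_h_e, smul_smul_complex]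
  lie_h_f := by
    rw [← smul_lie, ht.lie_h_f, ← neg_smul, smul_smul_complex, neg_smul]
  lie_e_f := by rw [← smul_lie, ht.lie_e_f]

/-! ### Hilbert's Theorem 90 for `SL(8)` over `ℂ / ℝ` -/

/-- For a complex matrix `c` there is a complex number `z` with `z + z̄ c` invertible. -/
theorem exists_det_ne_zero {n : Type} [Fintype n] [DecidableEq n] (c : Matrix n n ℂ) :
    ∃ z : ℂ, (z • (1 : Matrix n n ℂ) + starRingEnd ℂ z • c).det ≠ 0 := by
  by_contra! hcon
  -- Put `z = t + i` with `t` real, so that `z̄ = t - i`, and let `t` become an indeterminate. If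
  -- the determinant vanished for all real `t` it would be the zero polynomial, yet at `t = i` it is
  -- a power of `2i`.
  let P : Matrix n n (Polynomial ℂ) := (Polynomial.X + Polynomial.C Complex.I) • 1 +
    (Polynomial.X - Polynomial.C Complex.I) • c.map Polynomial.C
  have heval : ∀ t : ℂ, P.det.eval t = ((t + Complex.I) • (1 : Matrix n n ℂ) +
      (t - Complex.I) • c).det := by
    intro t
    rw [← Polynomial.coe_evalRingHom, RingHom.map_det]
    congr 1
    ext i j
    by_cases h : i = j <;> simp [P, h]
  have h0 : P.det = 0 := by
    refine Polynomial.eq_zero_of_infinite_isRoot _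
      (Set.infinite_of_injective_forall_mem (f := fun t : ℝ => (t : ℂ)) Complex.ofReal_injective ?_)
    intro t
    have := hcon (t + Complex.I)
    rw [map_add, Complex.conj_ofReal, Complex.conj_I, ← sub_eq_add_neg] at this
    exact (heval t).trans this
  have h1 := heval Complex.I
  rw [h0, sub_self, zero_smul, add_zero, Matrix.det_smul, Matrix.det_one, mul_one] at h1
  rw [Polynomial.eval_zero] at h1
  have h2 : Complex.I + Complex.I ≠ 0 := by simp [← two_mul]
  exact pow_ne_zero _ h2 h1.symm

/-- Every cocycle of `SL(8, ℂ)` with respect to complex conjugation is a coboundary. -/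
theorem exists_inv_mul_conjSL_eq {c : SL8C} (hc : c * conjSL c = 1) :
    ∃ g : SL8C, g⁻¹ * conjSL g = c := by
  have hc' : conjSL c * c = 1 := mul_eq_one_comm.mp hc
  obtain ⟨z, hz⟩ := exists_det_ne_zero (c : Matrix (Fin 8) (Fin 8) ℂ)
  set cbar : Matrix (Fin 8) (Fin 8) ℂ := (c : Matrix (Fin 8) (Fin 8) ℂ).map (starRingEnd ℂ)
    with hcbar
  have hcc : cbar * c = 1 := congrArg Subtype.val hc'
  -- The averaged element of Hilbert 90: `ā = z + z̄ c`, which equals `a c` because `c̄ c = 1`. Its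
  -- determinant is nonzero by the choice of `z`.
  set a : Matrix (Fin 8) (Fin 8) ℂ :=
    starRingEnd ℂ z • (1 : Matrix (Fin 8) (Fin 8) ℂ) + z • cbar with ha
  have hconj : a.map (starRingEnd ℂ) =
      z • (1 : Matrix (Fin 8) (Fin 8) ℂ) + starRingEnd ℂ z • (c : Matrix (Fin 8) (Fin 8) ℂ) := by
    ext i j
    by_cases h : i = j <;> simp [ha, hcbar, h]
  have hac : a.map (starRingEnd ℂ) = a * c := by
    rw [hconj, ha, Matrix.add_mul, Matrix.smul_mul, Matrix.smul_mul, hcc, Matrix.one_mul, add_comm]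
  have hdetc : a.det = starRingEnd ℂ a.det := by
    have h1 : starRingEnd ℂ a.det = (a.map (starRingEnd ℂ)).det := RingHom.map_det _ _
    rw [h1, hac, Matrix.det_mul, c.2, mul_one]
  have hdet : a.det ≠ 0 := by
    have h1 : starRingEnd ℂ a.det = (a.map (starRingEnd ℂ)).det := RingHom.map_det _ _
    rw [hdetc, h1, hconj]
    exact hz
  -- Since `det c = 1`, the number `det a` is real. Rescaling the first row of `a` by its inverse
  -- gives determinant one, and multiplication on the left by the real matrix `D` does not affect `ā
  -- = a c`.
  let D : Matrix (Fin 8) (Fin 8) ℂ := Matrix.diagonal (Function.update 1 0 a.det⁻¹)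
  have hD : D.map (starRingEnd ℂ) = D := by
    ext i j
    by_cases h : i = j
    · subst h
      by_cases hi : i = 0
      · subst hi; simp [D, ← hdetc]
      · simp [D, hi]
    · simp [D, h]
  have hDdet : D.det = a.det⁻¹ := by
    rw [Matrix.det_diagonal, Finset.prod_update_of_mem (Finset.mem_univ _)]
    simp
  let g : SL8C := ⟨D * a, by rw [Matrix.det_mul, hDdet, inv_mul_cancel₀ hdet]⟩
  refine ⟨g, ?_⟩
  rw [inv_mul_eq_iff_eq_mul]
  apply Subtype.ext
  change (D * a).map (starRingEnd ℂ) = D * a * c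
  rw [Matrix.map_mul, hD, hac, Matrix.mul_assoc]

/-- The elements of `SL(8, ℂ)` fixed by complex conjugation are those of `SL(8, ℝ)`. -/
theorem exists_real_of_conjSL_eq {g : SL8C} (hg : conjSL g = g) :
    ∃ r : SL8R, Matrix.SpecialLinearGroup.map (algebraMap ℝ ℂ) r = g := by
  have h1 : ∀ i j, ((g.1 i j).re : ℂ) = g.1 i j := fun i j =>
    Complex.conj_eq_iff_re.mp (congrFun (congrFun (congrArg Subtype.val hg) i) j)
  let R : Matrix (Fin 8) (Fin 8) ℝ := g.1.map Complex.re
  have h2 : R.map (algebraMap ℝ ℂ) = g.1 := by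
    ext i j
    exact h1 i j
  have h3 : R.det = 1 := by
    apply Complex.ofReal_injective
    have h4 : (algebraMap ℝ ℂ) R.det = (R.map (algebraMap ℝ ℂ)).det := RingHom.map_det _ _
    rw [h2, g.2] at h4
    simpa using h4
  exact ⟨⟨R, h3⟩, Subtype.ext h2⟩

theorem conjSL_map_real (r : SL8R) :
    conjSL (Matrix.SpecialLinearGroup.map (algebraMap ℝ ℂ) r) =
      Matrix.SpecialLinearGroup.map (algebraMap ℝ ℂ) r := by
  apply Subtype.ext
  ext i j
  exact Complex.conj_ofReal _

/-! ### Conjugacy of the `𝔰𝔩₂`-triples with a given nilpositive element -/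

instance : FiniteDimensional ℂ E7 :=
  inferInstanceAs (FiniteDimensional ℂ (LieAlgebra.SpecialLinear.sl (Fin 8) ℂ × Wedge4))

/-- `ad x` as an endomorphism of the vector space `𝔤`. -/
abbrev adE (x : E7) : Module.End ℂ E7 := LieAlgebra.ad ℂ E7 x

theorem adE_commutator (x y : E7) : adE x * adE y - adE y * adE x = adE ⁅x, y⁆ :=
  LinearMap.ext fun z => (lie_lie x y z).symm

theorem lie_mem_gZero {x y : E7} (hx : x ∈ E7.gZero) (hy : y ∈ E7.gZero) : ⁅x, y⁆ ∈ E7.gZero := by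
  have h1 : x.2 = 0 := hx
  have h2 : y.2 = 0 := hy
  change ⁅x, y⁆.2 = 0
  rw [E7.lie_snd, h1, h2, map_zero, map_zero, sub_zero]

namespace IsHomogeneousSl2Triple

variable {h e f : E7}

theorem commutator_h_e (ht : IsHomogeneousSl2Triple h e f) :
    adE h * adE e - adE e * adE h = (2 : ℂ) • adE e := by
  rw [adE_commutator, ht.lie_h_e]
  exact map_smul _ _ _

theorem commutator_e_f (ht : IsHomogeneousSl2Triple h e f) :
    adE e * adE f - adE f * adE e = adE h := by
  rw [adE_commutator, ht.lie_e_f]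

theorem isNilpotent_ad_e (ht : IsHomogeneousSl2Triple h e f) : IsNilpotent (adE e) :=
  isNilpotent_of_commutator_eq_smul two_ne_zero ht.commutator_h_e

/-- A triple is determined by `h` and `e`. -/
theorem f_unique (ht : IsHomogeneousSl2Triple h e f) {f' : E7}
    (ht' : IsHomogeneousSl2Triple h e f') : f = f' := by
  -- The difference `f - f'` commutes with `e` and has weight `-2`.
  refine sub_eq_zero.mp (eq_zero_of_neg_weight ht.commutator_h_e ht.commutator_e_f
    ht.isNilpotent_ad_e (x := f - f') ?_ ?_)
  · rw [LieAlgebra.ad_apply, lie_sub, ht.lie_e_f, ht'.lie_e_f, sub_self]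
  · rw [LieAlgebra.ad_apply, lie_sub, ht.lie_h_f, ht'.lie_h_f, smul_sub]
    abel

end IsHomogeneousSl2Triple

/-- An element `y ∈ 𝔤₀` with `[h, y] = c y`, `c ≠ 0`, and `[e, y] = 0` exponentiates to an element of
`SL(8, ℂ)` that fixes `e` and maps `h` to `h - c y`. -/
theorem exists_smul_eq_sub {h e y : E7} (hh : h ∈ E7.gZero) (he : e ∈ E7.gOne) (hy : y ∈ E7.gZero)
    {c : ℂ} (hc : c ≠ 0) (hhy : ⁅h, y⁆ = c • y) (hey : ⁅e, y⁆ = 0) :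
    ∃ u : SL8C, u • e = e ∧ u • h = h - c • y ∧ (conj y = y → conjSL u = u) := by
  have hh2 : h.2 = 0 := hh
  have hy2 : y.2 = 0 := hy
  have he1 : e.1 = 0 := he
  have h1 : (h.1 : Matrix (Fin 8) (Fin 8) ℂ) * y.1 - y.1 * h.1 = c • y.1 := by
    have := E7.lie_fst h y
    rw [hhy, hh2, map_zero, LinearMap.zero_apply, add_zero] at this
    exact this.symm
  have hn := isNilpotent_of_lie_eq_smul hc h1
  have h2 : act y.1 e.2 = 0 := by
    have := E7.lie_snd e y
    rw [hey, hy2, map_zero, zero_sub] at this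
    exact neg_eq_zero.mp this.symm
  refine ⟨expSL y.1 hn, ?_, ?_, fun hcy => conjSL_expSL hn ?_⟩
  · refine E7.ext' ?_ ?_
    · rw [smul_fst, he1]
      simp
    · rw [smul_snd]
      exact map_exp_of_act_eq_zero hn h2
  · refine E7.ext' ?_ ?_
    · rw [smul_fst]
      exact expSL_conj hn h1
    · have h3 : (h - c • y).2 = h.2 - c • y.2 := rfl
      rw [smul_snd, h3, hh2, hy2, map_zero, smul_zero, sub_zero]
  · rw [← conj_fst, hcy]

/-- Let `(h, e, f)` be a homogeneous triple. Every `h' ∈ 𝔤₀` with `[h', e] = 2 e` and `h' - h` in the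
image of `ad e` is of the form `u · h`, where `u` fixes `e`. If `h` and `h'` are real, then `u` can
be chosen real. -/
theorem exists_smul_h_eq {h e f h' : E7} (ht : IsHomogeneousSl2Triple h e f) (hh' : h' ∈ E7.gZero)
    (he : ⁅h', e⁆ = (2 : ℂ) • e) (hd : h' - h ∈ LinearMap.range (adE e)) :
    ∃ u : SL8C, u • e = e ∧ u • h = h' ∧ (h ∈ realForm → h' ∈ realForm → conjSL u = u) := by
  obtain ⟨N, hN⟩ := ht.isNilpotent_ad_e
  -- Here `k` is the current depth of `h' - h` in the filtration and `m` bounds the steps left. The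
  -- elements `e` and `h'` are fixed, while `h` and `f` change at every step.
  have key : ∀ m k : ℕ, 0 < k → N ≤ k + m → ∀ h f : E7, IsHomogeneousSl2Triple h e f →
      h' - h ∈ LinearMap.range (adE e ^ k) →
      ∃ u : SL8C, u • e = e ∧ u • h = h' ∧ (h ∈ realForm → h' ∈ realForm → conjSL u = u) := by
    intro m
    induction m with
    | zero =>
      intro k _ hk h f _ hd
      have h0 : adE e ^ k = 0 := pow_eq_zero_of_le hk hN
      rw [h0, LinearMap.range_zero, Submodule.mem_bot, sub_eq_zero] at hd
      exact ⟨1, one_smul _ _, by rw [one_smul, hd], fun _ _ => map_one _⟩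
    | succ m ih =>
      intro k hk0 hk h f ht hd
      -- Both neutral elements act on `e` by `2`, so their difference centralizes `e`.
      have hker : adE e (h' - h) = 0 := by
        rw [LieAlgebra.ad_apply, lie_sub, ← lie_skew, ← lie_skew e h, he, ht.lie_h_e, sub_self]
      obtain ⟨y, hy1, hy2, hy3, hy4⟩ := exists_weight_vector ht.commutator_h_e ht.commutator_e_f
        ht.isNilpotent_ad_e hker hd
      have hkc : (k : ℂ) ≠ 0 := by exact_mod_cast hk0.ne'
      -- The closure clause of `exists_weight_vector` is used twice: for the subspace `𝔤₀`, and
      -- below for the real form, which is closed only under real scalars.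
      have hyg : y ∈ E7.gZero :=
        hy4 E7.gZero.toAddSubgroup (fun x hx => lie_mem_gZero ht.h_mem hx)
          (fun r x hx => E7.gZero.smul_mem _ hx) (E7.gZero.sub_mem hh' ht.h_mem)
      have hyr : h ∈ realForm → h' ∈ realForm → conj y = y := by
        intro hr hr'
        let S : AddSubgroup E7 :=
          { carrier := realForm
            add_mem' := fun {a b} ha hb => (conj_add a b).trans (congrArg₂ _ ha hb)
            zero_mem' := show conj 0 = 0 by simpa using conj_smul_complex 0 0
            neg_mem' := fun {a} ha => (conj_neg a).trans (congrArg _ ha) }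
        exact hy4 S (fun x hx => (conj_lie h x).trans (congrArg₂ _ hr hx))
          (fun r x hx => (conj_smul_complex r x).trans
            (congrArg₂ _ (Complex.conj_ofReal r) hx)) (S.sub_mem hr' hr)
      -- Exponentiating `-y/k` gives `u · h = h + y`, which removes the weight `k` part of `h' - h`.
      -- The division is possible because the filtration starts at `k = 1`.
      obtain ⟨u, hu1, hu2, hu3⟩ := exists_smul_eq_sub (y := (-(k : ℂ)⁻¹) • y) ht.h_mem ht.e_mem
        (E7.gZero.smul_mem _ hyg) hkc
        (by rw [lie_smul, ← LieAlgebra.ad_apply ℂ, hy2, smul_comm])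
        (by rw [lie_smul, ← LieAlgebra.ad_apply ℂ, hy1, smul_zero])
      rw [smul_smul, mul_neg, mul_inv_cancel₀ hkc, neg_one_smul, sub_neg_eq_add] at hu2
      have ht2 := ht.smul u
      rw [hu1, hu2] at ht2
      obtain ⟨v, hv1, hv2, hv3⟩ := ih (k + 1) k.succ_pos (by omega) (h + y) (u • f) ht2
        (by rwa [← sub_sub])
      refine ⟨v * u, by rw [mul_smul, hu1, hv1], by rw [mul_smul, hu2, hv2], fun hr hr' => ?_⟩
      have hy := hyr hr hr'
      have hhy : h + y ∈ realForm := (conj_add h y).trans (congrArg₂ _ hr hy)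
      rw [map_mul, hv3 hhy hr', hu3]
      rw [conj_smul_complex, hy]
      simp
  exact key N 1 one_pos (by omega) h f ht (by rwa [pow_one])

/-- Two real triples with the same `e` are conjugate under a real element of the stabilizer of `e`. -/
theorem exists_real_smul_triple_eq {h e f h' f' : E7} (ht : IsHomogeneousSl2Triple h e f)
    (ht' : IsHomogeneousSl2Triple h' e f') (hr : h ∈ realForm) (hr' : h' ∈ realForm) :
    ∃ u : SL8C, conjSL u = u ∧ u • h = h' ∧ u • e = e ∧ u • f = f' := by
  obtain ⟨u, hu1, hu2, hu3⟩ := exists_smul_h_eq ht ht'.h_mem ht'.lie_h_e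
    ⟨f' - f, by rw [LieAlgebra.ad_apply, lie_sub, ht.lie_e_f, ht'.lie_e_f]⟩
  have ht2 := ht.smul u
  rw [hu1, hu2] at ht2
  exact ⟨u, hu3 hr hr', hu2, hu1, ht2.f_unique ht'⟩

theorem IsHomogeneousSl2Triple.conj {h e f : E7} (ht : IsHomogeneousSl2Triple h e f) :
    IsHomogeneousSl2Triple (conj h) (conj e) (conj f) where
  h_mem := by
    have h1 : h.2 = 0 := ht.h_mem
    change wedgeConj h.2 = 0
    rw [h1]
    simpa using wedgeConj_smul 0 (0 : Wedge4)
  e_mem := by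
    have h1 : e.1 = 0 := ht.e_mem
    change (SL8.conj e).1 = 0
    exact Subtype.ext (by rw [conj_fst, h1]; ext; simp)
  f_mem := by
    have h1 : f.1 = 0 := ht.f_mem
    change (SL8.conj f).1 = 0
    exact Subtype.ext (by rw [conj_fst, h1]; ext; simp)
  lie_h_e := by rw [← conj_lie, ht.lie_h_e, conj_smul_complex, map_ofNat]
  lie_h_f := by rw [← conj_lie, ht.lie_h_f, conj_neg, conj_smul_complex, map_ofNat]
  lie_e_f := by rw [← conj_lie, ht.lie_e_f]

/-- If `e` is real, a homogeneous triple `(h, e, f)` is conjugate to a real one under an element of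
the stabilizer of `e`. -/
theorem exists_smul_triple_real {h e f : E7} (ht : IsHomogeneousSl2Triple h e f)
    (he : e ∈ realForm) : ∃ u : SL8C, u • e = e ∧ u • h ∈ realForm ∧ u • f ∈ realForm := by
  have htc := ht.conj
  rw [show SL8.conj e = e from he] at htc
  -- The conditions `[h, e] = 2e` and `h ∈ [e, 𝔤]` are affine and stable under `σ`, as `e` is real.
  -- The average of `h` and its conjugate therefore satisfies them and is real.
  set h' : E7 := (2⁻¹ : ℂ) • (h + SL8.conj h) with hh'
  have hr : SL8.conj h' = h' := by
    rw [hh', conj_smul_complex, conj_add, conj_conj, add_comm, map_inv₀, map_ofNat]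
  obtain ⟨u, hu1, hu2, -⟩ := exists_smul_h_eq (h' := h') ht
    (E7.gZero.smul_mem _ (E7.gZero.add_mem ht.h_mem htc.h_mem))
    (by rw [hh', _root_.smul_lie, add_lie, ht.lie_h_e, htc.lie_h_e]; module)
    ⟨(2⁻¹ : ℂ) • (f + SL8.conj f) - f, by
      rw [LieAlgebra.ad_apply, lie_sub, lie_smul, lie_add, ht.lie_e_f, htc.lie_e_f]⟩
  have ht2 := ht.smul u
  rw [hu1, hu2] at ht2
  -- The triple and its conjugate share `h'` and `e`, so uniqueness of the third member forces `u ·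
  -- f` to be real.
  have ht2c := ht2.conj
  rw [show SL8.conj e = e from he, hr] at ht2c
  exact ⟨u, hu1, hu2 ▸ hr, ht2c.f_unique ht2⟩

/-! ### Real orbits and Galois cohomology -/

/-- `σ(g · x) = σ(g) · x = g c · x = g · x`. -/
theorem smul_mem_realForm {g c : SL8C} {x : E7} (hg : g⁻¹ * conjSL g = c) (hx : x ∈ realForm)
    (hc : c • x = x) : g • x ∈ realForm := by
  change conj (g • x) = g • x
  rw [conj_smul, show conj x = x from hx, inv_mul_eq_iff_eq_mul.mp hg, mul_smul, hc]

theorem orbit_smul_eq_of_conjSL_eq {u : SL8C} (hu : conjSL u = u) (x : E7) :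
    MulAction.orbit SL8R (u • x) = MulAction.orbit SL8R x := by
  obtain ⟨r, rfl⟩ := exists_real_of_conjSL_eq hu
  exact MulAction.orbit_smul r x

/-- The relation between the cocycles says exactly that `g' z g⁻¹` is real, and this element carries
`g · e` to `g' · e`. The case `z = 1` shows that the orbit does not depend on the choice of `g`. -/
theorem orbit_eq_of_coboundary_eq {g g' z c c' : SL8C} {e : E7} (hg : g⁻¹ * conjSL g = c)
    (hg' : g'⁻¹ * conjSL g' = c') (hz : c' = z * c * (conjSL z)⁻¹) (hze : z • e = e) :
    MulAction.orbit SL8R (g • e) = MulAction.orbit SL8R (g' • e) := by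
  have h1 : conjSL (g' * z * g⁻¹) = g' * z * g⁻¹ := by
    rw [map_mul, map_mul, map_inv, inv_mul_eq_iff_eq_mul.mp hg', inv_mul_eq_iff_eq_mul.mp hg, hz]
    group
  rw [← orbit_smul_eq_of_conjSL_eq h1 (g • e), ← mul_smul, inv_mul_cancel_right, mul_smul, hze]

theorem exists_coboundary {h e f : E7} (ht : IsRealHomogeneousSl2Triple h e f)
    (c : Cocycle (conjStabilizer ht)) : ∃ g : SL8C, g⁻¹ * conjSL g = c.1 :=
  exists_inv_mul_conjSL_eq (congrArg Subtype.val c.2)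

/-- The real orbit attached to a cocycle. -/
def cocycleOrbit {h e f : E7} (ht : IsRealHomogeneousSl2Triple h e f)
    (c : Cocycle (conjStabilizer ht)) : realOrbits e :=
  ⟨MulAction.orbit SL8R ((exists_coboundary ht c).choose • e),
    _, ⟨_, rfl⟩, smul_mem_realForm (exists_coboundary ht c).choose_spec ht.e_real c.1.2.1.2, rfl⟩

theorem cocycleOrbit_eq {h e f : E7} (ht : IsRealHomogeneousSl2Triple h e f)
    (c : Cocycle (conjStabilizer ht)) {g : SL8C} (hg : g⁻¹ * conjSL g = c.1) :
    (cocycleOrbit ht c : Set E7) = MulAction.orbit SL8R (g • e) :=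
  orbit_eq_of_coboundary_eq (z := 1) (exists_coboundary ht c).choose_spec hg (by simp) (one_smul _ _)

/-- Well-definedness and injectivity on classes together. An equality of orbits by itself only
relates the cocycles through the stabilizer of `e`; the conjugacy of real triples improves this to
`Z`. -/
theorem cocycleOrbit_eq_iff {h e f : E7} (ht : IsRealHomogeneousSl2Triple h e f)
    (c c' : Cocycle (conjStabilizer ht)) :
    cocycleOrbit ht c = cocycleOrbit ht c' ↔ (cocycleSetoid (conjStabilizer ht)).r c c' := by
  obtain ⟨g, hg⟩ := exists_coboundary ht c
  obtain ⟨g', hg'⟩ := exists_coboundary ht c'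
  rw [Subtype.ext_iff, cocycleOrbit_eq ht c hg, cocycleOrbit_eq ht c' hg']
  constructor
  · intro heq
    obtain ⟨r, hr⟩ : g' • e ∈ MulAction.orbit SL8R (g • e) := heq ▸ MulAction.mem_orbit_self _
    set R : SL8C := Matrix.SpecialLinearGroup.map (algebraMap ℝ ℂ) r with hR
    have hR' : conjSL R = R := conjSL_map_real r
    have hRe : (R * g) • e = g' • e := (mul_smul _ _ _).trans hr
    -- Replacing `g` by `R * g` with `R` real keeps the cocycle and makes the two translated triples
    -- share their second member.
    have hRg : (R * g)⁻¹ * conjSL (R * g) = c.1 := by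
      rw [map_mul, hR', ← hg]; group
    have ht1 := ht.toIsHomogeneousSl2Triple.smul (R * g)
    have ht2 := ht.toIsHomogeneousSl2Triple.smul g'
    rw [hRe] at ht1
    obtain ⟨u, hu, hu1, hu2, hu3⟩ := exists_real_smul_triple_eq ht1 ht2
      (smul_mem_realForm hRg ht.h_real c.1.2.1.1) (smul_mem_realForm hg' ht.h_real c'.1.2.1.1)
    rw [← hRe] at hu2
    have hfix : ∀ x : E7, u • (R * g) • x = g' • x → (g'⁻¹ * u * (R * g)) • x = x := by
      intro x hx
      rw [mul_smul, mul_smul, hx, inv_smul_smul]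
    -- The real element `u` matches the two translated triples, so this product fixes the original
    -- one. As `σ(u) = u`, it cancels in the twisted conjugation of `c`, leaving `g'⁻¹ σ(g')`.
    refine ⟨⟨g'⁻¹ * u * (R * g), ⟨hfix h hu1, hfix e (hu2.trans hRe)⟩, hfix f hu3⟩, ?_⟩
    apply Subtype.ext
    change (c'.1 : SL8C) = g'⁻¹ * u * (R * g) * c.1 * (conjSL (g'⁻¹ * u * (R * g)))⁻¹
    rw [← hg', ← hRg, map_mul conjSL (g'⁻¹ * u), map_mul conjSL g'⁻¹, hu, map_inv]
    group
  · rintro ⟨z, hz⟩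
    exact orbit_eq_of_coboundary_eq (z := z) hg hg' (congrArg Subtype.val hz) z.2.1.2

/-- For a real point `g · e`, correcting `g` by some `u` fixing that point makes the whole
translated triple real. Then `(u g)⁻¹ σ(u g)` fixes `h`, `e` and `f`, so it is a cocycle in `Z`, and
its orbit passes through `u g · e = g · e`. -/
theorem cocycleOrbit_surjective {h e f : E7} (ht : IsRealHomogeneousSl2Triple h e f) :
    Function.Surjective (cocycleOrbit ht) := by
  rintro ⟨_, x, ⟨g, rfl⟩, hx, rfl⟩
  obtain ⟨u, hu1, hu2, hu3⟩ := exists_smul_triple_real (ht.toIsHomogeneousSl2Triple.smul g) hx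
  have hfix : ∀ y : E7, y ∈ realForm → u • g • y ∈ realForm →
      ((u * g)⁻¹ * conjSL (u * g)) • y = y := by
    intro y hy hgy
    have h1 : conj ((u * g) • y) = (u * g) • y := by rw [mul_smul]; exact hgy
    rw [conj_smul, show conj y = y from hy] at h1
    rw [mul_smul, h1, inv_smul_smul]
  refine ⟨⟨⟨(u * g)⁻¹ * conjSL (u * g), ⟨hfix h ht.h_real hu2,
    hfix e ht.e_real (hu1.symm ▸ hx)⟩, hfix f ht.f_real hu3⟩, ?_⟩, ?_⟩
  · apply Subtype.ext
    change (u * g)⁻¹ * conjSL (u * g) * conjSL ((u * g)⁻¹ * conjSL (u * g)) = 1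
    rw [map_mul conjSL (u * g)⁻¹, conjSL_conjSL, map_inv]
    group
  · refine Subtype.ext ((cocycleOrbit_eq ht _ (g := u * g) rfl).trans ?_)
    rw [mul_smul]
    exact congrArg _ hu1

/-- The bijection from `H¹(Z, σ)` onto the set of real orbits. -/
def cohomologyEquivRealOrbits {h e f : E7} (ht : IsRealHomogeneousSl2Triple h e f) :
    H1 (conjStabilizer ht) ≃ realOrbits e :=
  Equiv.ofBijective
    (Quotient.lift (cocycleOrbit ht) fun c c' hc => (cocycleOrbit_eq_iff ht c c').mpr hc)
    ⟨by
      rintro ⟨c⟩ ⟨c'⟩ hcc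
      exact Quotient.sound ((cocycleOrbit_eq_iff ht c c').mp hcc), fun O => by
      obtain ⟨c, hc⟩ := cocycleOrbit_surjective ht O
      exact ⟨c.toH1, hc⟩⟩

end SL8

end

theorem mainTheorem4 (h e f : SL8.E7) (ht : SL8.IsRealHomogeneousSl2Triple h e f) :
    (∀ c : SL8.Cocycle (SL8.conjStabilizer ht), ∃ g : SL8.SL8C, g⁻¹ * SL8.conjSL g = c.1) ∧
    ∃ Φ : SL8.H1 (SL8.conjStabilizer ht) ≃ SL8.realOrbits e,
      ∀ (c : SL8.Cocycle (SL8.conjStabilizer ht)) (g : SL8.SL8C), g⁻¹ * SL8.conjSL g = c.1 →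
        g • e ∈ SL8.realForm ∧ (Φ c.toH1 : Set SL8.E7) = MulAction.orbit SL8.SL8R (g • e) :=
  ⟨SL8.exists_coboundary ht, SL8.cohomologyEquivRealOrbits ht, fun c _ hg =>
    ⟨SL8.smul_mem_realForm hg ht.e_real c.1.2.1.2, SL8.cocycleOrbit_eq ht c hg⟩⟩
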